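/- Let $d\ge 1$, let $F$ be a probability distribution on $\mathbb R$ with distribution function satisfying $F(0)=0$ and $F(R_{\max})=1$ for some finite constant $R_{\max}$, and let $\mathcal P$ be a homogeneous Poisson point process of unit intensity on $\mathbb R^d\times[0,\infty)$ whose points $(X,T)$ carry independent marks $R$ with distribution $F$. Let $(Q_n)$ be a sequence of finite subsets of $\mathbb Z^d$ with $\bigcup_{n}\bigcap_{m\ge n}Q_m=\mathbb Z^d$, and let $\tilde Q_n=Q_n\oplus[0,1)^d$. For $t\ge 0$, continuum ballistic deposition onto the substrate $\tilde Q_n\times\{0\}\subset\mathbb R^{d+1}$ is driven by the points of $\mathcal P$ in $\tilde Q_n\times[0,t]$, taken in increasing order of the time $T$: for each such point, a $(d+1)$-dimensional closed Euclidean ball of radius $R$ has its centre slide down the vertical line above $X$, starting from infinity, until the ball first touches the substrate or a previously deposited ball, and it stays there permanently. Let $A_{t,n}$ be the union of the substrate and all balls so deposited, and let $H_{t,n}(x)=\sup\{h:(x,h)\in A_{t,n}\}$ be the height of the interface above $x\in\tilde Q_n$ (every $x\in\mathbb R^d$ lies in $\tilde Q_n$ for all large $n$). Then for all $t\ge 0$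 and $x\in\mathbb R^d$ the limit $$H_t(x)=\lim_{n\to\infty}H_{t,n}(x)$$ exists almost surely and is almost surely finite. For each $t\ge 0$ the distribution of $H_t(x)$ does not depend on $x$. Moreover, for all $k\in\mathbb N$ and $t\ge 0$ the moment $E[H_t(\mathbf 0)^k]$ is finite, and $$E[H_t(\mathbf 0)^k]=O(t^k)\quad\text{as } t\to\infty .$$ -/

import Mathlib

open MeasureTheory ProbabilityTheory Filter Topology

noncomputable section

namespace BallisticDeposition

/-- Euclidean space `ℝ^d`, in which the substrate lies. -/
abbrev Space (d : ℕ) : Type := EuclideanSpace ℝ (Fin d)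

/-- Euclidean space `ℝ^(d+1)`, written as `ℝ^d × ℝ` with the Euclidean (`L²`) distance; the last
coordinate is the height. -/
abbrev UpperSpace (d : ℕ) : Type := WithLp 2 (Space d × ℝ)

/-- The point `(x, h)` of `ℝ^(d+1)`. -/
def pt {d : ℕ} (x : Space d) (h : ℝ) : UpperSpace d := WithLp.toLp 2 (x, h)

/-- An incoming particle `(X, T, R)`: spatial location `X`, arrival time `T`, radius (mark) `R`. -/
abbrev Particle (d : ℕ) : Type := Space d × ℝ × ℝ

namespace Particle

variable {d : ℕ}

/-- The spatial location of the particle. -/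
def loc (p : Particle d) : Space d := p.1

/-- The arrival time of the particle. -/
def time (p : Particle d) : ℝ := p.2.1

/-- The radius of the particle. -/
def radius (p : Particle d) : ℝ := p.2.2

end Particle

/-- `N` is a (simple) Poisson point process on `S` with diffuse intensity measure `μ`, given as a
random set of points: the number of points in each measurable set `B` of finite `μ`-measure is a
random variable with the Poisson law of mean `μ B` (so it is almost surely finite), and the numbers
of points in finitely many pairwise disjoint such sets are independent. -/
structure IsPoissonProcess {S Ω : Type*} [MeasurableSpace S] [MeasurableSpace Ω]
    (N : Ω → Set S) (μ : Measure S) (Pr : Measure Ω) : Prop where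
  measurable_count : ∀ B : Set S, MeasurableSet B → μ B ≠ ⊤ →
    Measurable fun ω => (N ω ∩ B).encard
  count_law : ∀ B : Set S, MeasurableSet B → μ B ≠ ⊤ → ∀ k : ℕ,
    Pr {ω | (N ω ∩ B).encard = k} = poissonMeasure (μ B).toNNReal {k}
  indep_count : ∀ (m : ℕ) (B : Fin m → Set S), (∀ i, MeasurableSet (B i)) → (∀ i, μ (B i) ≠ ⊤) →
    Pairwise (fun i j => Disjoint (B i) (B j)) →
    iIndepFun (fun i ω => (N ω ∩ B i).encard) Pr

/-- The intensity measure on `ℝ^d × ℝ × ℝ` of the homogeneous Poisson process of unit intensity on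
`ℝ^d × [0, ∞)` whose points carry independent marks of law `F`. -/
def markedIntensity (d : ℕ) (F : Measure ℝ) : Measure (Particle d) :=
  (volume : Measure (Space d)).prod ((volume.restrict (Set.Ici (0 : ℝ))).prod F)

/-- The region `Q ⊕ [0,1)^d` of `ℝ^d`. -/
def region {d : ℕ} (Q : Finset (Fin d → ℤ)) : Set (Space d) :=
  {x | ∃ z ∈ Q, ∀ i, x i - (z i : ℝ) ∈ Set.Ico (0 : ℝ) 1}

/-- The flat set `D × {0}` in `ℝ^(d+1)`. -/
def flat {d : ℕ} (D : Set (Space d)) : Set (UpperSpace d) := {y | ∃ x ∈ D, y = pt x 0}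

/-- The height at which the centre of a ball of radius `r` stops when it slides down the vertical
line above `x`, starting from infinity, until the (closed) ball first touches `A`. -/
def landingHeight {d : ℕ} (A : Set (UpperSpace d)) (x : Space d) (r : ℝ) : ℝ :=
  sSup {h : ℝ | (Metric.closedBall (pt x h) r ∩ A).Nonempty}

/-- The agglomeration (including the substrate `D × {0}`) after the deposition of a finite sequence
of particles. The list has the most recent arrival first. -/
def agglomeration {d : ℕ} (D : Set (Space d)) : List (Particle d) → Set (UpperSpace d)
  | [] => flat D
  | p :: l => agglomeration D l ∪
      Metric.closedBall (pt p.loc (landingHeight (agglomeration D l) p.loc p.radius)) p.radius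

open Classical in
/-- The particles of the configuration `C` listed in decreasing order of arrival time. If `C` is
finite and no two of its particles arrive at the same time, there is exactly one such list; in the
remaining case, which has probability zero here, the value is the empty list. -/
def arrivals {d : ℕ} (C : Set (Particle d)) : List (Particle d) :=
  if h : ∃ l : List (Particle d), l.Pairwise (fun p q => q.time < p.time) ∧ ∀ p, p ∈ l ↔ p ∈ C
  then h.choose else []

/-- The restriction of the configuration `C` to locations in `D` and arrival times in `[0, t]`. -/
def restrictTo {d : ℕ} (C : Set (Particle d)) (D : Set (Space d)) (t : ℝ) : Set (Particle d) :=
  {p ∈ C | p.loc ∈ D ∧ p.time ∈ Set.Icc 0 t}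

/-- The height above `x` of the interface at time `t` for ballistic deposition onto `D × {0}`
driven by the configuration `C`. -/
def height {d : ℕ} (C : Set (Particle d)) (D : Set (Space d)) (t : ℝ) (x : Space d) : ℝ :=
  sSup {h : ℝ | pt x h ∈ agglomeration D (arrivals (restrictTo C D t))}

/-- The infinite-substrate height `H_t(x)`: the limit in `n` of the heights for the substrates
`Q n ⊕ [0,1)^d` (it is meaningful where this limit exists in `ℝ`). -/
def limitHeight {d : ℕ} (C : Set (Particle d)) (Q : ℕ → Finset (Fin d → ℤ)) (t : ℝ)
    (x : Space d) : ℝ :=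
  limUnder atTop fun n => height C (region (Q n)) t x

end BallisticDeposition

end

/-! The proof rests on a last-passage formula. A falling ball stops at the highest of its possible
contacts: with the substrate at height `r`, or with an earlier ball, one square root above the
centre of that ball. Unwinding this recursion, the height above `x` is the maximum, over stacks
(chains of particles going back in time, consecutive ones touching when seen from above), of a sum
of square roots (`isGreatest_landingHeight`, `isGreatest_height`). The dynamics then disappears:
only the set of stacks below `x` matters.

Long stacks are rare. With cubes of side `2 * Rmax` and fine time slabs, a stack of `k` balls traces
a path of `k` neighbouring cells in distinct slabs. Counting these paths and using independence
bounds its probability by `a ^ k / k!`, where `a = (6 * Rmax) ^ d * (t + 1)`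
(`measure_exists_isPath_le`). So stack lengths are almost surely bounded, finitely many particles
matter, and the height is constant once the substrate covers them (`exists_isGreatest_pathHeights`).
A stack adds at most `2 * Rmax` per ball, and beyond length `2 * e * a`, which is of order `t`, the
length has a geometric tail; this gives the moments.

For stationarity, the limit at `x` is almost surely a measurable functional (`supHeight`) of the
configuration shifted by `x`, and the law of a Poisson process is determined by its intensity
(`IsPoissonProcess.identDistrib`), which is translation invariant. -/

namespace BallisticDeposition

/-! ### Stacks of balls and the deterministic height formula -/

variable {d : ℕ}

/-- The list `c` of particles (most recent first) is a stack supporting a ball of radius `r` above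
`x`: seen from above, each ball meets the next one. -/
def Touches (x : Space d) (r : ℝ) : List (Particle d) → Prop
  | [] => True
  | p :: c => dist x p.loc ≤ r + p.radius ∧ Touches p.loc p.radius c

/-- The height of the centre of a ball of radius `r` above `x` which rests on the stack `c`. -/
noncomputable def stackHeight (x : Space d) (r : ℝ) : List (Particle d) → ℝ
  | [] => r
  | p :: c => stackHeight p.loc p.radius c + √((r + p.radius) ^ 2 - dist x p.loc ^ 2)

/-- The heights at which a ball of radius `r` centred above `x` meets `A`. -/
def contacts (A : Set (UpperSpace d)) (x : Space d) (r : ℝ) : Set ℝ :=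
  {h : ℝ | (Metric.closedBall (pt x h) r ∩ A).Nonempty}

lemma dist_pt (x y : Space d) (h k : ℝ) :
    dist (pt x h) (pt y k) = √(dist x y ^ 2 + (h - k) ^ 2) := by
  rw [WithLp.prod_dist_eq_of_L2]
  simp [pt, Real.dist_eq, sq_abs]

lemma contacts_union (A B : Set (UpperSpace d)) (x : Space d) (r : ℝ) :
    contacts (A ∪ B) x r = contacts A x r ∪ contacts B x r := by
  ext h
  simp [contacts, Set.inter_union_distrib_left, Set.union_nonempty]

lemma mem_contacts_closedBall {x y : Space d} {r R k h : ℝ} (hr : 0 ≤ r) (hR : 0 ≤ R) :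
    h ∈ contacts (Metric.closedBall (pt y k) R) x r ↔
      dist x y ^ 2 + (h - k) ^ 2 ≤ (r + R) ^ 2 := by
  have key : h ∈ contacts (Metric.closedBall (pt y k) R) x r ↔
      dist (pt x h) (pt y k) ≤ r + R := by
    refine ⟨fun hh => Metric.dist_le_add_of_nonempty_closedBall_inter_closedBall hh, fun hh => ?_⟩
    obtain ⟨z, h1, h2⟩ := exists_dist_le_le hr hR (by rwa [add_comm])
    exact ⟨z, by simpa [dist_comm] using h1, by simpa using h2⟩
  rw [key, dist_pt, Real.sqrt_le_left (by positivity)]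

/-- At the highest contact the balls are tangent: the centres span a right triangle with hypotenuse
`r + R` and horizontal leg `dist x y`. -/
lemma isGreatest_contacts_closedBall {x y : Space d} {r R k : ℝ} (hr : 0 ≤ r) (hR : 0 ≤ R)
    (h : dist x y ≤ r + R) :
    IsGreatest (contacts (Metric.closedBall (pt y k) R) x r)
      (k + √((r + R) ^ 2 - dist x y ^ 2)) := by
  have h0 : 0 ≤ (r + R) ^ 2 - dist x y ^ 2 := by
    have := pow_le_pow_left₀ dist_nonneg h 2
    linarith
  refine ⟨?_, fun h' hh' => ?_⟩
  · rw [mem_contacts_closedBall hr hR, add_sub_cancel_left, Real.sq_sqrt h0]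
    linarith
  · rw [mem_contacts_closedBall hr hR] at hh'
    have : h' - k ≤ √((r + R) ^ 2 - dist x y ^ 2) := Real.le_sqrt_of_sq_le (by linarith)
    linarith

lemma contacts_closedBall_eq_empty {x y : Space d} {r R k : ℝ} (hr : 0 ≤ r) (hR : 0 ≤ R)
    (h : ¬ dist x y ≤ r + R) : contacts (Metric.closedBall (pt y k) R) x r = ∅ := by
  ext h'
  rw [mem_contacts_closedBall hr hR]
  have := pow_lt_pow_left₀ (not_le.1 h) (by positivity) two_ne_zero
  simp only [Set.mem_empty_iff_false, iff_false, not_le]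
  nlinarith [sq_nonneg (h' - k)]

lemma isGreatest_contacts_flat {D : Set (Space d)} {x : Space d} {r : ℝ} (hx : x ∈ D)
    (hr : 0 ≤ r) : IsGreatest (contacts (flat D) x r) r := by
  refine ⟨⟨pt x 0, ?_, x, hx, rfl⟩, ?_⟩
  · rw [Metric.mem_closedBall, dist_pt]
    simp [Real.sqrt_sq_eq_abs, abs_of_nonneg hr]
  · rintro h ⟨_, hz, y, -, rfl⟩
    rw [Metric.mem_closedBall, dist_pt, Real.sqrt_le_left hr] at hz
    nlinarith [sq_nonneg (dist y x)]

/-- The heights of the stacks that can be chosen from the deposited particles `l`. -/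
def stackHeights (l : List (Particle d)) (x : Space d) (r : ℝ) : Set ℝ :=
  {v | ∃ c, c.Sublist l ∧ Touches x r c ∧ stackHeight x r c = v}

lemma stackHeights_cons_of_touch (p : Particle d) (l : List (Particle d)) (x : Space d) (r : ℝ)
    (h : dist x p.loc ≤ r + p.radius) :
    stackHeights (p :: l) x r = stackHeights l x r ∪
      (fun v => v + √((r + p.radius) ^ 2 - dist x p.loc ^ 2)) ''
        stackHeights l p.loc p.radius := by
  ext v
  constructor
  · rintro ⟨c, hc, ht, rfl⟩
    rcases List.sublist_cons_iff.1 hc with hc | ⟨c', rfl, hc'⟩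
    · exact Or.inl ⟨c, hc, ht, rfl⟩
    · exact Or.inr ⟨_, ⟨c', hc', ht.2, rfl⟩, rfl⟩
  · rintro (⟨c, hc, ht, rfl⟩ | ⟨_, ⟨c, hc, ht, rfl⟩, rfl⟩)
    · exact ⟨c, hc.cons _, ht, rfl⟩
    · exact ⟨p :: c, hc.cons_cons _, ⟨h, ht⟩, rfl⟩

lemma stackHeights_cons_of_not_touch (p : Particle d) (l : List (Particle d)) (x : Space d) (r : ℝ)
    (h : ¬ dist x p.loc ≤ r + p.radius) :
    stackHeights (p :: l) x r = stackHeights l x r := by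
  ext v
  constructor
  · rintro ⟨c, hc, ht, rfl⟩
    rcases List.sublist_cons_iff.1 hc with hc | ⟨c', rfl, hc'⟩
    · exact ⟨c, hc, ht, rfl⟩
    · exact absurd ht.1 h
  · rintro ⟨c, hc, ht, rfl⟩
    exact ⟨c, hc.cons _, ht, rfl⟩

/-- The landing height is the largest height of a stack. -/
theorem isGreatest_landingHeight {D : Set (Space d)} (l : List (Particle d))
    (hl : ∀ p ∈ l, p.loc ∈ D ∧ 0 ≤ p.radius) (x : Space d) (hx : x ∈ D) (r : ℝ) (hr : 0 ≤ r) :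
    IsGreatest (contacts (agglomeration D l) x r) (landingHeight (agglomeration D l) x r) ∧
    IsGreatest (stackHeights l x r) (landingHeight (agglomeration D l) x r) := by
  -- Both maxima are carried together: the contacts identify the value of `sSup`, the stacks give
  -- the recursion.
  suffices h : ∃ M, IsGreatest (contacts (agglomeration D l) x r) M ∧
      IsGreatest (stackHeights l x r) M by
    obtain ⟨M, h1, h2⟩ := h
    have : landingHeight (agglomeration D l) x r = M := h1.csSup_eq
    rw [this]
    exact ⟨h1, h2⟩
  -- The new ball's own landing height is needed too, hence the hypothesis for all `x` and `r`.
  induction l generalizing x r with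
  | nil =>
    refine ⟨r, isGreatest_contacts_flat hx hr, ⟨[], List.nil_sublist _, trivial, rfl⟩, ?_⟩
    rintro _ ⟨c, hc, -, rfl⟩
    rw [List.sublist_nil.1 hc, stackHeight]
  | cons p l ih =>
    have hl' : ∀ p ∈ l, p.loc ∈ D ∧ 0 ≤ p.radius := fun q hq => hl q (List.mem_cons_of_mem _ hq)
    obtain ⟨hpD, hpR⟩ := hl p List.mem_cons_self
    obtain ⟨M, h1, h2⟩ := ih hl' x hx r hr
    obtain ⟨M', h1', h2'⟩ := ih hl' p.loc hpD p.radius hpR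
    have hM' : landingHeight (agglomeration D l) p.loc p.radius = M' := h1'.csSup_eq
    rw [agglomeration, contacts_union, hM']
    by_cases ht : dist x p.loc ≤ r + p.radius
    · rw [stackHeights_cons_of_touch p l x r ht]
      exact ⟨_, h1.union (isGreatest_contacts_closedBall hr hpR ht), h2.union
        ⟨Set.mem_image_of_mem _ h2'.1, by
          rintro _ ⟨v, hv, rfl⟩
          have := h2'.2 hv
          dsimp only
          linarith⟩⟩
    · rw [stackHeights_cons_of_not_touch p l x r ht, contacts_closedBall_eq_empty hr hpR ht,
        Set.union_empty]
      exact ⟨M, h1, h2⟩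

/-- The particles of the list arrive in decreasing order of time. -/
def Descending (c : List (Particle d)) : Prop := c.Pairwise fun p q => q.time < p.time

lemma Descending.nodup {c : List (Particle d)} (h : Descending c) : c.Nodup :=
  h.imp fun {a b} hab => by rintro rfl; exact lt_irrefl _ hab

/-- A list sorted strictly by time is determined by its members, so inclusion of members already
gives a sublist. -/
lemma Descending.sublist {c l : List (Particle d)} (hc : Descending c) (hl : Descending l)
    (h : ∀ p ∈ c, p ∈ l) : c.Sublist l := by
  have hsub : c.Subperm l := List.subperm_of_subset hc.nodup h
  obtain ⟨c', hp, hs⟩ := hsub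
  have hc' : Descending c' := List.Pairwise.sublist hs hl
  have : c' = c := hp.eq_of_pairwise
    (fun a b _ _ h1 h2 => absurd (h1.trans h2) (lt_irrefl _)) hc' hc
  exact this ▸ hs

lemma exists_descending_list {C : Set (Particle d)} (hC : C.Finite)
    (ht : ∀ p ∈ C, ∀ q ∈ C, p.time = q.time → p = q) :
    ∃ l : List (Particle d), l.Pairwise (fun p q => q.time < p.time) ∧ ∀ p, p ∈ l ↔ p ∈ C := by
  classical
  have hmem : ∀ p, p ∈ hC.toFinset.toList ↔ p ∈ C := by simp
  let r : Particle d → Particle d → Prop := fun p q => q.time ≤ p.time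
  have : Std.Total r := ⟨fun a b => le_total _ _⟩
  have : IsTrans (Particle d) r := ⟨fun a b c h1 h2 => le_trans h2 h1⟩
  refine ⟨hC.toFinset.toList.insertionSort r, ?_, by simp⟩
  have h1 := List.pairwise_insertionSort r hC.toFinset.toList
  have h2 : (hC.toFinset.toList.insertionSort r).Nodup :=
    (List.perm_insertionSort r _).nodup_iff.2 (Finset.nodup_toList _)
  refine (h1.and h2).imp_of_mem fun {a b} ha hb hab => lt_of_le_of_ne hab.1 fun h => hab.2 ?_
  rw [List.mem_insertionSort, hmem] at ha hb
  exact ht a ha b hb h.symm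

lemma arrivals_spec {C : Set (Particle d)} (hC : C.Finite)
    (ht : ∀ p ∈ C, ∀ q ∈ C, p.time = q.time → p = q) :
    Descending (arrivals C) ∧ ∀ p, p ∈ arrivals C ↔ p ∈ C := by
  have h := exists_descending_list hC ht
  rw [arrivals, dif_pos h]
  exact h.choose_spec

/-- The interface heights above `x` that are produced by stacks of particles of `C` arriving in the
time interval `[0, t]`. -/
def pathHeights (C : Set (Particle d)) (t : ℝ) (x : Space d) : Set ℝ :=
  {v | ∃ c, Descending c ∧ (∀ p ∈ c, p ∈ C ∧ p.time ∈ Set.Icc 0 t) ∧ Touches x 0 c ∧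
    stackHeight x 0 c = v}

/-- The interface is probed by a ball of radius zero. -/
lemma height_eq_landingHeight (C : Set (Particle d)) (D : Set (Space d)) (t : ℝ) (x : Space d) :
    height C D t x = landingHeight (agglomeration D (arrivals (restrictTo C D t))) x 0 := by
  simp [height, landingHeight]

/-- Finiteness and distinct times ensure that `arrivals` is the true list and not its default value;
its sublists are then exactly the descending lists of available particles. -/
theorem isGreatest_height {C : Set (Particle d)} {D : Set (Space d)} {t : ℝ} {x : Space d}
    (hx : x ∈ D) (hC : (restrictTo C D t).Finite)
    (ht : ∀ p ∈ restrictTo C D t, ∀ q ∈ restrictTo C D t, p.time = q.time → p = q)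
    (hR : ∀ p ∈ restrictTo C D t, 0 ≤ p.radius) :
    IsGreatest (pathHeights {p ∈ C | p.loc ∈ D} t x) (height C D t x) := by
  obtain ⟨h1, h2⟩ := arrivals_spec hC ht
  have key := (isGreatest_landingHeight (D := D) (arrivals (restrictTo C D t))
    (fun p hp => ⟨((h2 p).1 hp).2.1, hR p ((h2 p).1 hp)⟩) x hx 0 le_rfl).2
  rw [height_eq_landingHeight]
  convert key using 1
  ext v
  constructor
  · rintro ⟨c, hd, hm, htc, rfl⟩
    exact ⟨c, hd.sublist h1 fun p hp => (h2 p).2 ⟨(hm p hp).1.1, (hm p hp).1.2, (hm p hp).2⟩,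
      htc, rfl⟩
  · rintro ⟨c, hs, htc, rfl⟩
    refine ⟨c, List.Pairwise.sublist hs h1, fun p hp => ?_, htc, rfl⟩
    have := (h2 p).1 (hs.subset hp)
    exact ⟨⟨this.1, this.2.1⟩, this.2.2⟩

/-! ### Height, spread, truncation and translation of stacks -/

/-- Each square root is at most the sum of the two radii involved, so every ball of the stack
contributes at most its diameter. -/
lemma stackHeight_le {Rmax : ℝ} (c : List (Particle d)) (x : Space d) (r : ℝ) (hr : 0 ≤ r)
    (hc : ∀ p ∈ c, 0 ≤ p.radius ∧ p.radius ≤ Rmax) :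
    stackHeight x r c ≤ r + 2 * Rmax * c.length := by
  induction c generalizing x r with
  | nil => simp [stackHeight]
  | cons p c ih =>
    obtain ⟨hp0, hpR⟩ := hc p List.mem_cons_self
    have h1 := ih p.loc p.radius hp0 fun q hq => hc q (List.mem_cons_of_mem _ hq)
    have h2 : √((r + p.radius) ^ 2 - dist x p.loc ^ 2) ≤ r + p.radius := by
      rw [Real.sqrt_le_left (by positivity)]
      nlinarith [sq_nonneg (dist x p.loc)]
    simp only [stackHeight, List.length_cons, Nat.cast_add, Nat.cast_one]
    linarith

lemma Touches.dist_le {Rmax : ℝ} {c : List (Particle d)} {x : Space d} {r : ℝ} (hr : r ≤ Rmax)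
    (hc : ∀ p ∈ c, p.radius ≤ Rmax) (h : Touches x r c) :
    ∀ p ∈ c, dist x p.loc ≤ 2 * Rmax * c.length := by
  induction c generalizing x r with
  | nil => simp
  | cons p c ih =>
    have hpR := hc p List.mem_cons_self
    have ih := ih hpR (fun q hq => hc q (List.mem_cons_of_mem _ hq)) h.2
    have h1 := h.1
    have h0 : 0 ≤ 2 * Rmax * c.length := by
      have : 0 ≤ dist x p.loc := dist_nonneg
      have : 0 ≤ Rmax := by linarith
      positivity
    intro q hq
    simp only [List.length_cons, Nat.cast_add, Nat.cast_one]
    rcases List.mem_cons.1 hq with rfl | hq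
    · linarith
    · have := ih q hq
      have := dist_triangle x p.loc q.loc
      linarith

/-- Excluding stacks of length exactly `k` thereby excludes all longer ones. -/
lemma Touches.take {c : List (Particle d)} {x : Space d} {r : ℝ} (h : Touches x r c)
    (k : ℕ) : Touches x r (c.take k) := by
  induction c generalizing x r k with
  | nil => simpa using h
  | cons p c ih =>
    cases k with
    | zero => trivial
    | succ k => exact ⟨h.1, ih h.2 k⟩

/-- Translation of a particle by `-v` in space. -/
def shift (v : Space d) (p : Particle d) : Particle d := (p.loc - v, p.time, p.radius)

lemma touches_map_shift (v : Space d) (c : List (Particle d)) (x : Space d) (r : ℝ) :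
    Touches (x - v) r (c.map (shift v)) ↔ Touches x r c := by
  induction c generalizing x r with
  | nil => simp [Touches]
  | cons p c ih =>
    have := ih p.loc p.radius
    simp only [List.map_cons, Touches]
    rw [show (shift v p).loc = p.loc - v from rfl, show (shift v p).radius = p.radius from rfl,
      this, dist_sub_right]

lemma stackHeight_map_shift (v : Space d) (c : List (Particle d)) (x : Space d) (r : ℝ) :
    stackHeight (x - v) r (c.map (shift v)) = stackHeight x r c := by
  induction c generalizing x r with
  | nil => simp [stackHeight]
  | cons p c ih =>
    have := ih p.loc p.radius
    simp only [List.map_cons, stackHeight]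
    rw [show (shift v p).loc = p.loc - v from rfl, show (shift v p).radius = p.radius from rfl,
      this, dist_sub_right]

lemma pathHeights_image_shift (C : Set (Particle d)) (t : ℝ) (x v : Space d) :
    pathHeights (shift v '' C) t (x - v) = pathHeights C t x := by
  have hinv : ∀ p, shift (-v) (shift v p) = p := fun p => by
    simp [shift, Particle.loc, Particle.time, Particle.radius]
  ext a
  constructor
  · rintro ⟨c, hd, hm, ht, rfl⟩
    have hx : x = (x - v) - (-v) := by simp
    refine ⟨c.map (shift (-v)), ?_, ?_, ?_, ?_⟩
    · exact List.pairwise_map.2 hd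
    · intro q hq
      obtain ⟨p, hp, rfl⟩ := List.mem_map.1 hq
      obtain ⟨⟨p', hp', rfl⟩, h2⟩ := hm p hp
      exact ⟨by rwa [hinv], h2⟩
    · rw [hx, touches_map_shift]; exact ht
    · conv_lhs => rw [hx, stackHeight_map_shift]
  · rintro ⟨c, hd, hm, ht, rfl⟩
    refine ⟨c.map (shift v), List.pairwise_map.2 hd, ?_, (touches_map_shift v c x 0).2 ht,
      stackHeight_map_shift v c x 0⟩
    intro q hq
    obtain ⟨p, hp, rfl⟩ := List.mem_map.1 hq
    exact ⟨⟨p, (hm p hp).1, rfl⟩, (hm p hp).2⟩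

end BallisticDeposition

/-! ### The law of a Poisson process and elementary estimates -/

namespace BallisticDeposition

/-- `count_law` speaks of finite counts only; the mass at `⊤` is recovered from the total mass 1. -/
lemma enat_measure_ext {μ ν : Measure ℕ∞} [IsProbabilityMeasure μ] [IsProbabilityMeasure ν]
    (h : ∀ k : ℕ, μ {(k : ℕ∞)} = ν {(k : ℕ∞)}) : μ = ν := by
  refine Measure.ext_of_singleton fun a => ?_
  induction a using ENat.recTopCoe with
  | coe k => exact h k
  | top =>
    have hc : ({⊤} : Set ℕ∞) = (⋃ k : ℕ, {(k : ℕ∞)})ᶜ := by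
      ext a
      induction a using ENat.recTopCoe <;> simp
    have hd : Pairwise (Function.onFun Disjoint fun k : ℕ => ({(k : ℕ∞)} : Set ℕ∞)) :=
      fun i j hij => by simpa [Function.onFun] using hij
    have hm : MeasurableSet (⋃ k : ℕ, ({(k : ℕ∞)} : Set ℕ∞)) := .of_discrete
    rw [hc, prob_compl_eq_one_sub hm, prob_compl_eq_one_sub hm,
      measure_iUnion hd fun _ => .of_discrete, measure_iUnion hd fun _ => .of_discrete]
    simp_rw [h]

section Poisson

variable {S Ω : Type*} [MeasurableSpace S] [MeasurableSpace Ω] {Pr : Measure Ω}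
  {μ : Measure S} {N N' : Ω → Set S}

lemma IsPoissonProcess.map_count [IsProbabilityMeasure Pr] (hN : IsPoissonProcess N μ Pr)
    {B : Set S} (hB : MeasurableSet B) (hμ : μ B ≠ ⊤) :
    Pr.map (fun ω => (N ω ∩ B).encard) =
      (poissonMeasure (μ B).toNNReal).map (fun k : ℕ => (k : ℕ∞)) := by
  have := Measure.isProbabilityMeasure_map (μ := Pr) (hN.measurable_count B hB hμ).aemeasurable
  have := Measure.isProbabilityMeasure_map (μ := poissonMeasure (μ B).toNNReal)
    (f := fun k : ℕ => (k : ℕ∞)) Measurable.of_discrete.aemeasurable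
  refine enat_measure_ext fun k => ?_
  rw [Measure.map_apply (hN.measurable_count B hB hμ) .of_discrete,
    Measure.map_apply .of_discrete .of_discrete]
  have hk : (fun k : ℕ => (k : ℕ∞)) ⁻¹' {(k : ℕ∞)} = {k} := by
    ext j
    simp
  rw [hk]
  exact hN.count_law B hB hμ k

lemma IsPoissonProcess.iIndepFun_count (hN : IsPoissonProcess N μ Pr) {ι : Type*} [Fintype ι]
    {B : ι → Set S} (hB : ∀ i, MeasurableSet (B i)) (hμ : ∀ i, μ (B i) ≠ ⊤)
    (hd : Pairwise fun i j => Disjoint (B i) (B j)) :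
    iIndepFun (fun i ω => (N ω ∩ B i).encard) Pr := by
  let e := Fintype.equivFin ι
  have h := hN.indep_count (Fintype.card ι) (fun k => B (e.symm k)) (fun k => hB _)
    (fun k => hμ _) fun i j hij => hd (e.symm.injective.ne hij)
  have := h.precomp e.injective
  simpa using this

lemma IsPoissonProcess.identDistrib_disjoint [IsProbabilityMeasure Pr]
    (hN : IsPoissonProcess N μ Pr) (hN' : IsPoissonProcess N' μ Pr) {ι : Type*} [Fintype ι]
    {B : ι → Set S} (hB : ∀ i, MeasurableSet (B i)) (hμ : ∀ i, μ (B i) ≠ ⊤)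
    (hd : Pairwise fun i j => Disjoint (B i) (B j)) :
    IdentDistrib (fun ω i => (N ω ∩ B i).encard) (fun ω i => (N' ω ∩ B i).encard) Pr Pr := by
  have hm := fun i => hN.measurable_count (B i) (hB i) (hμ i)
  have hm' := fun i => hN'.measurable_count (B i) (hB i) (hμ i)
  refine ⟨(measurable_pi_lambda _ hm).aemeasurable, (measurable_pi_lambda _ hm').aemeasurable, ?_⟩
  rw [(iIndepFun_iff_map_fun_eq_pi_map fun i => (hm i).aemeasurable).1
      (hN.iIndepFun_count hB hμ hd),
    (iIndepFun_iff_map_fun_eq_pi_map fun i => (hm' i).aemeasurable).1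
      (hN'.iIndepFun_count hB hμ hd)]
  congr 1
  ext1 i
  rw [hN.map_count (hB i) (hμ i), hN'.map_count (hB i) (hμ i)]

/-- The atoms of the algebra of sets generated by a finite family, except that the atom outside all
the sets of the family is replaced by `∅`. -/
def atom {ι : Type*} (B : ι → Set S) (J : Finset ι) : Set S :=
  {s | J.Nonempty ∧ ∀ i, s ∈ B i ↔ i ∈ J}

lemma measurableSet_atom {ι : Type*} [Fintype ι] {B : ι → Set S} (hB : ∀ i, MeasurableSet (B i))
    (J : Finset ι) : MeasurableSet (atom B J) := by
  by_cases hJ : J.Nonempty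
  · have : atom B J = ⋂ i, {s | s ∈ B i ↔ i ∈ J} := by
      ext s
      simp [atom, hJ]
    rw [this]
    refine MeasurableSet.iInter fun i => ?_
    by_cases hi : i ∈ J
    · simpa [hi] using hB i
    · simp only [hi, iff_false]
      exact (hB i).compl
  · simp [atom, hJ]

omit [MeasurableSpace S] in
lemma disjoint_atom {ι : Type*} (B : ι → Set S) :
    Pairwise fun I J => Disjoint (atom B I) (atom B J) := by
  intro I J hIJ
  refine Set.disjoint_left.2 fun s hI hJ => hIJ ?_
  ext i
  rw [← hI.2, hJ.2]

lemma measure_atom_ne_top {ι : Type*} {B : ι → Set S} (hμ : ∀ i, μ (B i) ≠ ⊤) (J : Finset ι) :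
    μ (atom B J) ≠ ⊤ := by
  by_cases hJ : J.Nonempty
  · obtain ⟨i, hi⟩ := hJ
    exact measure_ne_top_of_subset (fun s hs => (hs.2 i).2 hi) (hμ i)
  · simp [atom, hJ]

omit [MeasurableSpace S] in
open Classical in
lemma encard_inter_eq_sum_atom {ι : Type*} [Fintype ι] (B : ι → Set S) (C : Set S) (i : ι) :
    (C ∩ B i).encard = ∑ J : Finset ι, if i ∈ J then (C ∩ atom B J).encard else 0 := by
  have h : C ∩ B i = ⋃ J : Finset ι, if i ∈ J then C ∩ atom B J else ∅ := by
    ext s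
    simp only [Set.mem_iUnion]
    constructor
    · rintro ⟨hs, hi⟩
      refine ⟨Finset.univ.filter fun j => s ∈ B j, ?_⟩
      rw [if_pos (by simpa using hi)]
      exact ⟨hs, ⟨i, by simpa using hi⟩, by simp⟩
    · rintro ⟨J, hJ⟩
      split_ifs at hJ with hi
      · exact ⟨hJ.1, (hJ.2.2 i).2 hi⟩
      · exact hJ.elim
  rw [h, Set.encard_iUnion_of_finite, finsum_eq_sum_of_fintype]
  · exact Finset.sum_congr rfl fun J _ => by split_ifs <;> simp
  · intro I J hIJ
    simp only [Function.onFun]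
    split_ifs
    · exact (disjoint_atom B hIJ).mono Set.inter_subset_right Set.inter_subset_right
    all_goals simp

/-- Counts in overlapping sets are fixed sums of counts in the disjoint atoms, whose joint law is a
product of Poisson laws. -/
lemma IsPoissonProcess.identDistrib_fintype [IsProbabilityMeasure Pr]
    (hN : IsPoissonProcess N μ Pr) (hN' : IsPoissonProcess N' μ Pr) {ι : Type*} [Fintype ι]
    {B : ι → Set S} (hB : ∀ i, MeasurableSet (B i)) (hμ : ∀ i, μ (B i) ≠ ⊤) :
    IdentDistrib (fun ω i => (N ω ∩ B i).encard) (fun ω i => (N' ω ∩ B i).encard) Pr Pr := by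
  classical
  have h := hN.identDistrib_disjoint hN' (measurableSet_atom hB) (measure_atom_ne_top hμ)
    (disjoint_atom B)
  have := h.comp (u := fun (f : Finset ι → ℕ∞) i => ∑ J : Finset ι, if i ∈ J then f J else 0)
    Measurable.of_discrete
  simp_rw [encard_inter_eq_sum_atom B]
  exact this

/-- The test sets: measurable sets of finite intensity. -/
abbrev TestSet (μ : Measure S) : Type _ := {B : Set S // MeasurableSet B ∧ μ B ≠ ⊤}

/-- Configurations of points, with the σ-algebra generated by the counts in the test sets. -/
def Config (_ : Measure S) : Type _ := Set S

/-- The counts of a configuration in all the test sets. -/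
noncomputable def Config.counts (C : Config μ) : TestSet μ → ℕ∞ :=
  fun B => Set.encard ((show Set S from C) ∩ B.1)

noncomputable instance : MeasurableSpace (Config μ) := MeasurableSpace.comap Config.counts inferInstance

lemma Config.measurable_count {B : Set S} (hB : MeasurableSet B) (hμ : μ B ≠ ⊤) :
    Measurable fun C : Config μ => Set.encard ((show Set S from C) ∩ B) :=
  (measurable_pi_apply (⟨B, hB, hμ⟩ : TestSet μ)).comp (comap_measurable Config.counts)

lemma IsPoissonProcess.measurable_config (hN : IsPoissonProcess N μ Pr) :
    Measurable fun ω => (show Config μ from N ω) :=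
  measurable_comap_iff.2 <| measurable_pi_lambda _ fun B =>
    hN.measurable_count B.1 B.2.1 B.2.2

/-- The law of a Poisson process is determined by its intensity. -/
theorem IsPoissonProcess.identDistrib [IsProbabilityMeasure Pr]
    (hN : IsPoissonProcess N μ Pr) (hN' : IsPoissonProcess N' μ Pr) :
    IdentDistrib (fun ω => (show Config μ from N ω)) (fun ω => (show Config μ from N' ω))
      Pr Pr := by
  have hm : Measurable fun ω (B : TestSet μ) => (N ω ∩ B.1).encard :=
    measurable_pi_lambda _ fun B => hN.measurable_count B.1 B.2.1 B.2.2
  have hm' : Measurable fun ω (B : TestSet μ) => (N' ω ∩ B.1).encard :=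
    measurable_pi_lambda _ fun B => hN'.measurable_count B.1 B.2.1 B.2.2
  -- The law of the whole family of counts is determined by its finite-dimensional marginals.
  have key := (identDistrib_iff_forall_finset_identDistrib (P := Pr) hm.aemeasurable
    hm'.aemeasurable).2 fun I => hN.identDistrib_fintype hN' (B := fun i : I => i.1.1)
      (fun i => i.1.2.1) fun i => i.1.2.2
  refine ⟨hN.measurable_config.aemeasurable, hN'.measurable_config.aemeasurable, ?_⟩
  ext E hE
  obtain ⟨A, hA, rfl⟩ := hE
  rw [Measure.map_apply hN.measurable_config ⟨A, hA, rfl⟩,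
    Measure.map_apply hN'.measurable_config ⟨A, hA, rfl⟩]
  exact key.measure_mem_eq hA

/-- A measure preserving injection maps a Poisson process to a Poisson process. -/
lemma IsPoissonProcess.image (hN : IsPoissonProcess N μ Pr) {f : S → S}
    (hf : MeasurePreserving f μ μ) (hinj : f.Injective) :
    IsPoissonProcess (fun ω => f '' N ω) μ Pr := by
  have hcount : ∀ (B : Set S) ω, (f '' N ω ∩ B).encard = (N ω ∩ f ⁻¹' B).encard := fun B ω => by
    rw [← Set.image_inter_preimage, hinj.encard_image]
  have hμ : ∀ B, MeasurableSet B → μ (f ⁻¹' B) = μ B := fun B hB =>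
    hf.measure_preimage hB.nullMeasurableSet
  refine ⟨fun B hB hB' => ?_, fun B hB hB' k => ?_, fun m B hB hB' hd => ?_⟩ <;>
    simp only [hcount]
  · exact hN.measurable_count _ (hf.measurable hB) (by rwa [hμ B hB])
  · rw [← hμ B hB]
    exact hN.count_law _ (hf.measurable hB) (by rwa [hμ B hB]) k
  · exact hN.indep_count m _ (fun i => hf.measurable (hB i)) (fun i => by rw [hμ _ (hB i)]; exact hB' i)
      fun i j hij => (hd hij).preimage f

lemma IsPoissonProcess.ae_finite [IsProbabilityMeasure Pr] (hN : IsPoissonProcess N μ Pr)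
    {B : Set S} (hB : MeasurableSet B) (hμ : μ B ≠ ⊤) : ∀ᵐ ω ∂Pr, (N ω ∩ B).Finite := by
  have h := hN.map_count hB hμ
  have h1 : ∀ᵐ a ∂(Pr.map fun ω => (N ω ∩ B).encard), a ≠ ⊤ := by
    rw [h, ae_map_iff Measurable.of_discrete.aemeasurable .of_discrete]
    simp
  filter_upwards [ae_of_ae_map (hN.measurable_count B hB hμ).aemeasurable h1] with ω hω
  rwa [Set.encard_ne_top_iff] at hω

/-- With `a` the mean, this is `1 - exp (-a) ≤ a`. -/
lemma IsPoissonProcess.measure_nonempty_le [IsProbabilityMeasure Pr]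
    (hN : IsPoissonProcess N μ Pr) {B : Set S} (hB : MeasurableSet B) (hμ : μ B ≠ ⊤) :
    Pr {ω | (N ω ∩ B).Nonempty} ≤ μ B := by
  have h0 := hN.count_law B hB hμ 0
  have hm : MeasurableSet {ω | (N ω ∩ B).encard = ((0 : ℕ) : ℕ∞)} :=
    hN.measurable_count B hB hμ (measurableSet_singleton _)
  have hc : {ω | (N ω ∩ B).Nonempty} = {ω | (N ω ∩ B).encard = ((0 : ℕ) : ℕ∞)}ᶜ := by
    ext ω
    simp [Set.nonempty_iff_ne_empty]
  rw [hc, prob_compl_eq_one_sub hm, h0, poissonMeasure_singleton]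
  conv_rhs => rw [← ENNReal.coe_toNNReal hμ]
  set a := (μ B).toNNReal
  have h1 := Real.add_one_le_exp (-(a : ℝ))
  rw [tsub_le_iff_right, ← ENNReal.ofReal_coe_nnreal, ← ENNReal.ofReal_add (by positivity)
    (by positivity), ← ENNReal.ofReal_one]
  refine ENNReal.ofReal_le_ofReal ?_
  simp
  linarith

/-- From `exp (-a) ≥ 1 - a`: the probability `1 - (1 + a) * exp (-a)` is at most `1 - (1 + a) * (1 -
a) = a ^ 2`. -/
lemma IsPoissonProcess.measure_nontrivial_le [IsProbabilityMeasure Pr]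
    (hN : IsPoissonProcess N μ Pr) {B : Set S} (hB : MeasurableSet B) (hμ : μ B ≠ ⊤) :
    Pr {ω | (N ω ∩ B).Nontrivial} ≤ μ B ^ 2 := by
  have h0 := hN.count_law B hB hμ 0
  have h1 := hN.count_law B hB hμ 1
  have hm0 : MeasurableSet {ω | (N ω ∩ B).encard = ((0 : ℕ) : ℕ∞)} :=
    hN.measurable_count B hB hμ (measurableSet_singleton _)
  have hm1 : MeasurableSet {ω | (N ω ∩ B).encard = ((1 : ℕ) : ℕ∞)} :=
    hN.measurable_count B hB hμ (measurableSet_singleton _)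
  have hc : {ω | (N ω ∩ B).Nontrivial} = ({ω | (N ω ∩ B).encard = ((0 : ℕ) : ℕ∞)} ∪
      {ω | (N ω ∩ B).encard = ((1 : ℕ) : ℕ∞)})ᶜ := by
    ext ω
    rw [Set.mem_ofPred_eq, ← Set.not_subsingleton_iff, ← Set.encard_le_one_iff_subsingleton,
      Set.encard_le_one_iff_eq, Set.mem_compl_iff, Set.mem_union]
    simp [Set.encard_eq_one]
  have hd : Disjoint {ω | (N ω ∩ B).encard = ((0 : ℕ) : ℕ∞)}
      {ω | (N ω ∩ B).encard = ((1 : ℕ) : ℕ∞)} :=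
    Set.disjoint_left.2 fun ω h h' => by
      rw [Set.mem_ofPred_eq] at h h'
      rw [h] at h'
      simp at h'
  rw [hc, prob_compl_eq_one_sub (hm0.union hm1), measure_union hd hm1, h0, h1,
    poissonMeasure_singleton, poissonMeasure_singleton]
  conv_rhs => rw [← ENNReal.coe_toNNReal hμ]
  set a := (μ B).toNNReal
  have h1 := Real.add_one_le_exp (-(a : ℝ))
  have h2 : (0 : ℝ) ≤ a := a.2
  rw [tsub_le_iff_right, ← ENNReal.ofReal_coe_nnreal, ← ENNReal.ofReal_pow (by positivity),
    ← ENNReal.ofReal_add (by positivity) (by positivity),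
    ← ENNReal.ofReal_add (by positivity) (by positivity), ← ENNReal.ofReal_one]
  refine ENNReal.ofReal_le_ofReal ?_
  simp
  nlinarith

lemma IsPoissonProcess.ae_empty [IsProbabilityMeasure Pr] (hN : IsPoissonProcess N μ Pr)
    {B : Set S} (hB : MeasurableSet B) (hμ : μ B = 0) : ∀ᵐ ω ∂Pr, N ω ∩ B = ∅ := by
  have h := hN.measure_nonempty_le hB (by simp [hμ])
  rw [hμ, nonpos_iff_eq_zero, measure_eq_zero_iff_ae_notMem] at h
  filter_upwards [h] with ω hω
  simpa [Set.not_nonempty_iff_eq_empty] using hω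

lemma IsPoissonProcess.measure_forall_nonempty_le [IsProbabilityMeasure Pr]
    (hN : IsPoissonProcess N μ Pr) {ι : Type*} [Fintype ι]
    {B : ι → Set S} (hB : ∀ i, MeasurableSet (B i)) (hμ : ∀ i, μ (B i) ≠ ⊤)
    (hd : Pairwise fun i j => Disjoint (B i) (B j)) :
    Pr {ω | ∀ i, (N ω ∩ B i).Nonempty} ≤ ∏ i, μ (B i) := by
  have h := iIndepFun_iff_measure_inter_preimage_eq_mul.1 (hN.iIndepFun_count hB hμ hd)
    Finset.univ (sets := fun _ => {0}ᶜ) fun i _ => .of_discrete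
  have he : {ω | ∀ i, (N ω ∩ B i).Nonempty} =
      ⋂ i ∈ Finset.univ, (fun ω => (N ω ∩ B i).encard) ⁻¹' {0}ᶜ := by
    ext ω
    simp [Set.nonempty_iff_ne_empty]
  rw [he, h]
  refine Finset.prod_le_prod' fun i _ => le_trans (le_of_eq ?_)
    (hN.measure_nonempty_le (hB i) (hμ i))
  congr 1
  ext ω
  simp [Set.nonempty_iff_ne_empty]

/-! ### Measurable events about tuples of points -/

/-- The counting measure of the configuration `C` in the window `W`, provided that it is finite. -/
noncomputable def Config.windowMeasure (W : Set S) (C : Config μ) : Measure S :=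
  open Classical in
  if Set.Finite ((show Set S from C) ∩ W) then Measure.count.restrict ((show Set S from C) ∩ W)
  else 0

variable [MeasurableSingletonClass S]

instance (W : Set S) (C : Config μ) : IsFiniteMeasure (Config.windowMeasure W C) := by
  unfold Config.windowMeasure
  split_ifs with h
  · refine ⟨?_⟩
    rw [Measure.restrict_apply_univ]
    exact Measure.count_apply_lt_top.2 h
  · infer_instance

lemma Config.measurable_windowMeasure {W : Set S} (hW : MeasurableSet W) (hμ : μ W ≠ ⊤) :
    Measurable (Config.windowMeasure (μ := μ) W) := by
  refine Measure.measurable_of_measurable_coe _ fun B hB => ?_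
  have h : (fun C : Config μ => Config.windowMeasure W C B) = fun C : Config μ =>
      if Set.encard ((show Set S from C) ∩ W) = ⊤ then 0 else
        (Set.encard ((show Set S from C) ∩ (W ∩ B)) : ENNReal) := by
    ext C
    unfold Config.windowMeasure
    by_cases hf : Set.Finite ((show Set S from C) ∩ W)
    · rw [if_pos hf, if_neg (by simpa [Set.encard_eq_top_iff] using hf),
        Measure.restrict_apply hB, Measure.count_apply (hB.inter hf.measurableSet)]
      congr 2
      rw [Set.inter_comm B, Set.inter_assoc]
    · rw [if_neg hf, if_pos (by simpa [Set.encard_eq_top_iff] using hf)]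
      rfl
  rw [h]
  refine Measurable.ite ?_ measurable_const ?_
  · exact Config.measurable_count hW hμ (measurableSet_singleton _)
  · exact (Measurable.of_discrete (f := fun n : ℕ∞ => (n : ENNReal))).comp
      (Config.measurable_count (hW.inter hB)
        (measure_ne_top_of_subset Set.inter_subset_left hμ))

omit [MeasurableSingletonClass S] in
lemma measurable_pi_measure {α : Type*} [MeasurableSpace α] (k : ℕ) {ν : α → Measure S}
    [∀ a, IsFiniteMeasure (ν a)] (hν : Measurable ν) :
    Measurable fun a => Measure.pi fun _ : Fin k => ν a := by
  refine Measurable.measure_of_isPiSystem generateFrom_pi.symm isPiSystem_pi ?_ ?_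
  · rintro _ ⟨B, hB, rfl⟩
    simp_rw [Measure.pi_pi]
    exact Finset.measurable_prod _ fun i _ => (Measure.measurable_coe (hB i (Set.mem_univ i))).comp hν
  · simp_rw [Measure.pi_univ]
    exact Finset.measurable_prod _ fun i _ => (Measure.measurable_coe MeasurableSet.univ).comp hν

/-- The existence of a tuple of points in a given measurable set is a measurable event. -/
theorem Config.measurableSet_exists_tuple {W : Set S} (hW : MeasurableSet W) (hμ : μ W ≠ ⊤)
    {k : ℕ} {G : Set (Fin k → S)} (hG : MeasurableSet G) :
    MeasurableSet {C : Config μ | Set.Finite ((show Set S from C) ∩ W) ∧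
      ∃ p : Fin k → S, (∀ i, p i ∈ (show Set S from C) ∩ W) ∧ p ∈ G} := by
  have hfin : MeasurableSet {C : Config μ | Set.Finite ((show Set S from C) ∩ W)} := by
    have : {C : Config μ | Set.Finite ((show Set S from C) ∩ W)} =
        (fun C : Config μ => Set.encard ((show Set S from C) ∩ W)) ⁻¹' {⊤}ᶜ := by
      ext C
      simp
    rw [this]
    exact Config.measurable_count hW hμ .of_discrete
  -- Some tuple of points lies in `G` exactly when the product of the counting measures charges `G`,
  -- and this product depends measurably on the configuration.
  have hpi : MeasurableSet {C : Config μ |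
      Measure.pi (fun _ : Fin k => Config.windowMeasure W C) G ≠ 0} :=
    ((Measure.measurable_coe hG).comp (measurable_pi_measure k
      (Config.measurable_windowMeasure hW hμ))) (measurableSet_singleton 0).compl
  convert hfin.inter hpi using 1
  ext C
  simp only [Set.mem_ofPred_eq, Set.mem_inter_iff]
  refine and_congr_right fun hf => ?_
  have hw : Config.windowMeasure W C = Measure.count.restrict ((show Set S from C) ∩ W) :=
    if_pos hf
  constructor
  · rintro ⟨p, hp, hpG⟩ h0
    have h1 : Measure.pi (fun _ : Fin k => Config.windowMeasure W C) {p} = 1 := by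
      rw [← Set.univ_pi_singleton, Measure.pi_pi]
      refine Finset.prod_eq_one fun i _ => ?_
      rw [hw, Measure.restrict_apply (measurableSet_singleton _),
        Set.inter_eq_left.2 (Set.singleton_subset_iff.2 (hp i)), Measure.count_singleton]
    have h2 := measure_mono_null (Set.singleton_subset_iff.2 hpG) h0
    rw [h1] at h2
    exact one_ne_zero h2
  · intro h0
    by_contra hcon
    push Not at hcon
    refine h0 ?_
    have h1 : ∀ᵐ p ∂Measure.pi (fun _ : Fin k => Config.windowMeasure W C),
        ∀ i, p i ∈ (show Set S from C) ∩ W := by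
      refine eventually_all.2 fun i => Measure.tendsto_eval_ae_ae.eventually ?_
      rw [hw]
      exact ae_restrict_mem hf.measurableSet
    rw [measure_eq_zero_iff_ae_notMem]
    filter_upwards [h1] with p hp using hcon p hp

end Poisson

/-! ### Measurability of the height functional -/

section Measurability

variable {α : Type*} [MeasurableSpace α]

lemma measurable_loc : Measurable (Particle.loc : Particle d → Space d) := measurable_fst

lemma measurable_time : Measurable (Particle.time : Particle d → ℝ) :=
  measurable_fst.comp measurable_snd

lemma measurable_radius : Measurable (Particle.radius : Particle d → ℝ) :=
  measurable_snd.comp measurable_snd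

/-- The base point and radius vary with `a` because the recursion replaces them by those of the
first particle. -/
lemma measurable_stackHeight {k : ℕ} {x : α → Space d} {r : α → ℝ} {p : α → Fin k → Particle d}
    (hx : Measurable x) (hr : Measurable r) (hp : Measurable p) :
    Measurable fun a => stackHeight (x a) (r a) (List.ofFn (p a)) := by
  induction k generalizing x r with
  | zero => simpa [stackHeight] using hr
  | succ k ih =>
    simp only [List.ofFn_succ, stackHeight]
    have h0 : Measurable fun a => p a 0 := (measurable_pi_apply 0).comp hp
    have hl := measurable_loc.comp h0
    have hR := measurable_radius.comp h0
    have hs : Measurable fun a (i : Fin k) => p a i.succ :=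
      measurable_pi_lambda _ fun i => (measurable_pi_apply i.succ).comp hp
    exact (ih hl hR hs).add (((hr.add hR).pow_const 2).sub ((hx.dist hl).pow_const 2)).sqrt

lemma measurableSet_touches {k : ℕ} {x : α → Space d} {r : α → ℝ} {p : α → Fin k → Particle d}
    (hx : Measurable x) (hr : Measurable r) (hp : Measurable p) :
    MeasurableSet {a | Touches (x a) (r a) (List.ofFn (p a))} := by
  induction k generalizing x r with
  | zero => simp [Touches]
  | succ k ih =>
    simp only [List.ofFn_succ, Touches]
    have h0 : Measurable fun a => p a 0 := (measurable_pi_apply 0).comp hp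
    have hl := measurable_loc.comp h0
    have hR := measurable_radius.comp h0
    have hs : Measurable fun a (i : Fin k) => p a i.succ :=
      measurable_pi_lambda _ fun i => (measurable_pi_apply i.succ).comp hp
    exact (measurableSet_le (hx.dist hl) (hr.add hR)).inter (ih hl hR hs)

lemma measurableSet_descending (k : ℕ) :
    MeasurableSet {p : Fin k → Particle d | Descending (List.ofFn p)} := by
  simp only [Descending, List.pairwise_ofFn]
  have : {p : Fin k → Particle d | ∀ ⦃i j : Fin k⦄, i < j → (p j).time < (p i).time} =
      ⋂ i, ⋂ j, ⋂ (_ : i < j), {p | (p j).time < (p i).time} := by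
    ext p
    simp
  rw [this]
  exact MeasurableSet.iInter fun i => MeasurableSet.iInter fun j => MeasurableSet.iInter fun _ =>
    measurableSet_lt (measurable_time.comp (measurable_pi_apply j))
      (measurable_time.comp (measurable_pi_apply i))

end Measurability

lemma markedIntensity_box {F : Measure ℝ} [IsProbabilityMeasure F] (A : Set (Space d))
    (I J : Set ℝ) (hI : MeasurableSet I) :
    markedIntensity d F {p | p.loc ∈ A ∧ p.time ∈ I ∧ p.radius ∈ J} =
      volume A * (volume (I ∩ Set.Ici 0) * F J) := by
  rw [← Measure.restrict_apply hI, ← Measure.prod_prod, ← Measure.prod_prod]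
  rfl

lemma volume_box (a b : Fin d → ℝ) :
    volume {x : Space d | ∀ i, x i ∈ Set.Ico (a i) (b i)} =
      ∏ i, ENNReal.ofReal (b i - a i) := by
  rw [← Real.volume_pi_Ico, ← (PiLp.volume_preserving_ofLp (Fin d)).measure_preimage
    (MeasurableSet.univ_pi fun i => measurableSet_Ico).nullMeasurableSet]
  congr 1
  ext x
  simp only [Set.mem_preimage, Set.mem_univ_pi]
  rfl

/-- An exhausting sequence of space-time windows. -/
def window (d : ℕ) (t : ℝ) (M : ℕ) : Set (Particle d) :=
  {p | (∀ i, p.loc i ∈ Set.Ico (-M : ℝ) M) ∧ p.time ∈ Set.Icc 0 t}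

lemma measurableSet_box (a b : Fin d → ℝ) :
    MeasurableSet {x : Space d | ∀ i, x i ∈ Set.Ico (a i) (b i)} := by
  have : {x : Space d | ∀ i, x i ∈ Set.Ico (a i) (b i)} =
      ⋂ i, (fun x : Space d => x i) ⁻¹' Set.Ico (a i) (b i) := by
    ext x
    simp
  rw [this]
  exact MeasurableSet.iInter fun i =>
    (by fun_prop : Measurable fun x : Space d => x i) measurableSet_Ico

lemma measurableSet_window (t : ℝ) (M : ℕ) : MeasurableSet (window d t M) :=
  (measurable_loc (measurableSet_box (fun _ => (-M : ℝ)) fun _ => (M : ℝ))).inter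
    (measurable_time measurableSet_Icc)

lemma markedIntensity_window_ne_top {F : Measure ℝ} [IsProbabilityMeasure F] (t : ℝ) (M : ℕ) :
    markedIntensity d F (window d t M) ≠ ⊤ := by
  have h : window d t M = {p | p.loc ∈ {x : Space d | ∀ i, x i ∈ Set.Ico (-M : ℝ) M} ∧
      p.time ∈ Set.Icc 0 t ∧ p.radius ∈ Set.univ} := by
    ext p
    simp [window]
  rw [h, markedIntensity_box _ _ _ measurableSet_Icc, volume_box (fun _ => (-M : ℝ)) fun _ => (M : ℝ)]
  refine ENNReal.mul_ne_top (ENNReal.prod_ne_top fun _ _ => ENNReal.ofReal_ne_top)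
    (ENNReal.mul_ne_top ?_ (measure_ne_top _ _))
  refine measure_ne_top_of_subset Set.inter_subset_left ?_
  simp

lemma exists_mem_window {t : ℝ} {p : Particle d} (hp : p.time ∈ Set.Icc 0 t) :
    ∀ᶠ M in atTop, p ∈ window d t M := by
  have : ∀ i, ∀ᶠ M : ℕ in atTop, p.loc i ∈ Set.Ico (-M : ℝ) M := fun i => by
    filter_upwards [tendsto_natCast_atTop_atTop.eventually_gt_atTop |p.loc i|] with M hM
    exact ⟨(abs_lt.1 hM).1.le, (abs_lt.1 hM).2⟩
  filter_upwards [eventually_all.2 this] with M hM using ⟨hM, hp⟩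

/-- The supremum of the stack heights over the stacks in `C`, as a measurable functional. -/
noncomputable def supHeight (F : Measure ℝ) (t : ℝ) (x : Space d)
    (C : Config (markedIntensity d F)) : ENNReal :=
  ⨆ (k : ℕ) (M : ℕ) (p : Fin k → Particle d)
    (_ : Set.Finite ((show Set (Particle d) from C) ∩ window d t M) ∧
      (∀ i, p i ∈ (show Set (Particle d) from C) ∩ window d t M) ∧
      Descending (List.ofFn p) ∧ Touches x 0 (List.ofFn p)),
    ENNReal.ofReal (stackHeight x 0 (List.ofFn p))

theorem measurable_supHeight (F : Measure ℝ) [IsProbabilityMeasure F] (t : ℝ) (x : Space d) :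
    Measurable (supHeight F t x) := by
  refine measurable_of_Ioi fun a => ?_
  -- The supremum over uncountably many tuples becomes a countable union over lengths and windows of
  -- tuple events.
  have h : supHeight F t x ⁻¹' Set.Ioi a = ⋃ (k : ℕ) (M : ℕ),
      {C : Config (markedIntensity d F) |
        Set.Finite ((show Set (Particle d) from C) ∩ window d t M) ∧
        ∃ p : Fin k → Particle d, (∀ i, p i ∈ (show Set (Particle d) from C) ∩ window d t M) ∧
          p ∈ {p | Descending (List.ofFn p)} ∩ {p | Touches x 0 (List.ofFn p)} ∩
            {p | a < ENNReal.ofReal (stackHeight x 0 (List.ofFn p))}} := by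
    ext C
    simp only [Set.mem_preimage, Set.mem_Ioi, supHeight, lt_iSup_iff, Set.mem_iUnion,
      Set.mem_ofPred_eq, Set.mem_inter_iff]
    constructor
    · rintro ⟨k, M, p, ⟨h1, h2, h3, h4⟩, h5⟩
      exact ⟨k, M, h1, p, h2, ⟨h3, h4⟩, h5⟩
    · rintro ⟨k, M, h1, p, h2, ⟨h3, h4⟩, h5⟩
      exact ⟨k, M, p, ⟨h1, h2, h3, h4⟩, h5⟩
  rw [h]
  refine MeasurableSet.iUnion fun k => MeasurableSet.iUnion fun M =>
    Config.measurableSet_exists_tuple (measurableSet_window t M)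
      (markedIntensity_window_ne_top t M) ?_
  refine ((measurableSet_descending k).inter (measurableSet_touches measurable_const
    measurable_const measurable_id)).inter ?_
  exact measurableSet_lt measurable_const
    (measurable_stackHeight measurable_const measurable_const measurable_id).ennreal_ofReal

/-- A stack is finite, so some window contains it and cutting to windows loses nothing. -/
theorem supHeight_eq {F : Measure ℝ} {t : ℝ} {x : Space d} {C : Set (Particle d)} {H : ℝ}
    (hC : ∀ M, (C ∩ window d t M).Finite) (hH : IsGreatest (pathHeights C t x) H) :
    supHeight F t x C = ENNReal.ofReal H := by
  refine le_antisymm ?_ ?_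
  · refine iSup_le fun k => iSup_le fun M => iSup_le fun p => iSup_le fun hp => ?_
    refine ENNReal.ofReal_le_ofReal (hH.2 ⟨List.ofFn p, hp.2.2.1, fun q hq => ?_, hp.2.2.2, rfl⟩)
    obtain ⟨i, rfl⟩ := (List.mem_ofFn' _ _).1 hq
    exact ⟨(hp.2.1 i).1, (hp.2.1 i).2.2⟩
  · obtain ⟨c, hd, hm, ht, rfl⟩ := hH.1
    have h1 : ∀ᶠ M in atTop, ∀ i : Fin c.length, c.get i ∈ window d t M :=
      eventually_all.2 fun i => exists_mem_window (hm _ (c.get_mem i)).2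
    obtain ⟨M, hM⟩ := h1.exists
    refine le_iSup_of_le c.length (le_iSup_of_le M (le_iSup_of_le c.get
      (le_iSup_of_le ⟨hC M, fun i => ⟨(hm _ (c.get_mem i)).1, hM i⟩, ?_⟩ ?_)))
    · rw [List.ofFn_get]
      exact ⟨hd, ht⟩
    · rw [List.ofFn_get]

/-! ### Space-time cells and the counting of cell paths -/

/-- The index of the cube of side `s` that contains `x`. -/
noncomputable def cubeIndex (s : ℝ) (x : Space d) : Fin d → ℤ := fun i => ⌊x i / s⌋

/-- The index of the time slab of length `2⁻ᵐ` that contains `u`. -/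
noncomputable def slabIndex (m : ℕ) (u : ℝ) : ℕ := ⌊u * 2 ^ m⌋₊

/-- Space-time cells: products of a cube of side `s` and a time slab of length `2⁻ᵐ`. -/
def cell (s : ℝ) (m : ℕ) (a : (Fin d → ℤ) × ℕ) : Set (Particle d) :=
  {p | cubeIndex s p.loc = a.1 ∧ 0 ≤ p.time ∧ slabIndex m p.time = a.2}

lemma cell_eq_box {s : ℝ} (hs : 0 < s) (m : ℕ) (a : (Fin d → ℤ) × ℕ) :
    cell s m a = {p | p.loc ∈ {x : Space d | ∀ i, x i ∈ Set.Ico (s * a.1 i) (s * (a.1 i + 1))} ∧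
      p.time ∈ Set.Ico ((a.2 : ℝ) / 2 ^ m) ((a.2 + 1) / 2 ^ m) ∧ p.radius ∈ Set.univ} := by
  ext p
  simp only [cell, slabIndex, Set.mem_ofPred_eq, Set.mem_univ, and_true, Set.mem_Ico]
  refine and_congr ?_ ?_
  · rw [funext_iff]
    refine forall_congr' fun i => ?_
    change ⌊p.loc i / s⌋ = a.1 i ↔ _
    rw [Int.floor_eq_iff, le_div_iff₀ hs, div_lt_iff₀ hs, mul_comm s, mul_comm s]
  · have h2 : (0 : ℝ) < 2 ^ m := by positivity
    rw [div_le_iff₀ h2, lt_div_iff₀ h2]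
    constructor
    · rintro ⟨h0, h⟩
      rwa [Nat.floor_eq_iff (by positivity)] at h
    · rintro ⟨h, h'⟩
      have h0 : 0 ≤ p.time * 2 ^ m := le_trans (Nat.cast_nonneg _) h
      exact ⟨nonneg_of_mul_nonneg_left h0 h2, (Nat.floor_eq_iff h0).2 ⟨h, h'⟩⟩

lemma measurableSet_cell {s : ℝ} (hs : 0 < s) (m : ℕ) (a : (Fin d → ℤ) × ℕ) :
    MeasurableSet (cell s m a) := by
  rw [cell_eq_box hs]
  exact (measurable_loc (measurableSet_box _ _)).inter
    ((measurable_time measurableSet_Ico).inter (measurable_radius MeasurableSet.univ))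

lemma markedIntensity_cell_le {F : Measure ℝ} [IsProbabilityMeasure F] {s : ℝ} (hs : 0 < s)
    (m : ℕ) (a : (Fin d → ℤ) × ℕ) :
    markedIntensity d F (cell s m a) ≤ ENNReal.ofReal (s ^ d / 2 ^ m) := by
  rw [cell_eq_box hs, markedIntensity_box _ _ _ measurableSet_Ico, volume_box, measure_univ,
    mul_one]
  refine (mul_le_mul_right (measure_mono Set.inter_subset_left) _).trans ?_
  rw [Real.volume_Ico, ← sub_div]
  simp only [mul_add, add_sub_cancel_left, mul_one, Finset.prod_const, Finset.card_univ,
    Fintype.card_fin]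
  rw [← ENNReal.ofReal_pow hs.le, ← ENNReal.ofReal_mul (by positivity)]
  refine ENNReal.ofReal_le_ofReal (le_of_eq ?_)
  ring

/-- Distinct slabs suffice, so a path may return to a cube and still meet independent cells. -/
lemma disjoint_cell {s : ℝ} {m : ℕ} {a b : (Fin d → ℤ) × ℕ} (h : a.2 ≠ b.2) :
    Disjoint (cell s m a) (cell s m b) :=
  Set.disjoint_left.2 fun _ hp hq => h (hp.2.2.symm.trans hq.2.2)

/-- The cubes that touch the cube `z`, including `z` itself. -/
noncomputable def nearby (z : Fin d → ℤ) : Finset (Fin d → ℤ) :=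
  Fintype.piFinset fun i => Finset.Icc (z i - 1) (z i + 1)

lemma card_nearby (z : Fin d → ℤ) : (nearby z).card = 3 ^ d := by
  have h : ∀ i, (Finset.Icc (z i - 1) (z i + 1)).card = 3 := fun i => by
    rw [Int.card_Icc]
    omega
  simp [nearby, Fintype.card_piFinset, h]

lemma cubeIndex_mem_nearby {s : ℝ} (hs : 0 < s) {x y : Space d} (h : dist x y ≤ s) :
    cubeIndex s y ∈ nearby (cubeIndex s x) := by
  refine Fintype.mem_piFinset.2 fun i => ?_
  have h1 : |x i - y i| ≤ s := by
    have := (EuclideanSpace.dist_eq x y) ▸ h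
    have h2 : dist (x i) (y i) ^ 2 ≤ ∑ i, dist (x i) (y i) ^ 2 :=
      Finset.single_le_sum (f := fun i => dist (x i) (y i) ^ 2) (fun i _ => by positivity)
        (Finset.mem_univ i)
    exact (Real.le_sqrt_of_sq_le h2).trans this
  obtain ⟨h2, h3⟩ := abs_le.1 h1
  have h4 : x i / s ≤ y i / s + 1 := by
    rw [div_add_one hs.ne', div_le_div_iff_of_pos_right hs]
    linarith
  have h5 : y i / s ≤ x i / s + 1 := by
    rw [div_add_one hs.ne', div_le_div_iff_of_pos_right hs]
    linarith
  have h6 := Int.floor_le_floor h4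
  have h7 := Int.floor_le_floor h5
  rw [Int.floor_add_one] at h6 h7
  simp only [cubeIndex, Finset.mem_Icc]
  omega

open Classical in
/-- The sequences of `k` cells which start near the cube `z`, move between touching cubes, and whose
slabs decrease strictly from below `n`. -/
noncomputable def cellPaths : ℕ → (Fin d → ℤ) → ℕ → Finset (List ((Fin d → ℤ) × ℕ))
  | 0, _, _ => {[]}
  | k + 1, z, n => (Finset.range n).biUnion fun j => (nearby z).biUnion fun z' =>
      (cellPaths k z' j).image (List.cons (z', j))

lemma sum_range_choose_eq (n k : ℕ) : ∑ j ∈ Finset.range n, j.choose k = n.choose (k + 1) := by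
  induction n with
  | zero => simp
  | succ n ih => rw [Finset.sum_range_succ, ih, Nat.choose_succ_succ, add_comm]

/-- Each step has `3 ^ d` choices of cube, and strictly decreasing slabs amount to a `k`-subset of
`range n`; the induction is the hockey-stick identity. -/
lemma card_cellPaths_le (k : ℕ) (z : Fin d → ℤ) (n : ℕ) :
    (cellPaths k z n).card ≤ (3 ^ d) ^ k * n.choose k := by
  induction k generalizing z n with
  | zero => simp [cellPaths]
  | succ k ih =>
    rw [cellPaths]
    calc _ ≤ ∑ j ∈ Finset.range n, ∑ z' ∈ nearby z, (3 ^ d) ^ k * j.choose k :=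
          Finset.card_biUnion_le.trans <| Finset.sum_le_sum fun j _ =>
            Finset.card_biUnion_le.trans <| Finset.sum_le_sum fun z' _ =>
              Finset.card_image_le.trans (ih z' j)
      _ = (3 ^ d) ^ (k + 1) * n.choose (k + 1) := by
          simp only [Finset.sum_const, card_nearby, smul_eq_mul]
          rw [← sum_range_choose_eq, Finset.mul_sum]
          exact Finset.sum_congr rfl fun j _ => by ring

lemma cons_mem_cellPaths {k : ℕ} {z z' : Fin d → ℤ} {n j : ℕ} {q : List ((Fin d → ℤ) × ℕ)} :
    (z', j) :: q ∈ cellPaths (k + 1) z n ↔ j < n ∧ z' ∈ nearby z ∧ q ∈ cellPaths k z' j := by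
  simp only [cellPaths, Finset.mem_biUnion, Finset.mem_image, Finset.mem_range]
  constructor
  · rintro ⟨j', hj, z'', hz, q', hq, he⟩
    simp only [List.cons.injEq, Prod.mk.injEq] at he
    obtain ⟨⟨rfl, rfl⟩, rfl⟩ := he
    exact ⟨hj, hz, hq⟩
  · rintro ⟨hj, hz, hq⟩
    exact ⟨j, hj, z', hz, q, hq, rfl⟩

lemma cellPaths_spec {k : ℕ} {z : Fin d → ℤ} {n : ℕ} {q : List ((Fin d → ℤ) × ℕ)}
    (hq : q ∈ cellPaths k z n) :
    q.length = k ∧ (∀ a ∈ q, a.2 < n) ∧ q.Pairwise fun a b => b.2 < a.2 := by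
  induction k generalizing z n q with
  | zero =>
    rw [cellPaths, Finset.mem_singleton] at hq
    simp [hq]
  | succ k ih =>
    cases q with
    | nil => simp [cellPaths] at hq
    | cons a q =>
      obtain ⟨hj, -, hq⟩ := cons_mem_cellPaths.1 hq
      obtain ⟨h1, h2, h3⟩ := ih hq
      refine ⟨by simp [h1], ?_, List.pairwise_cons.2 ⟨h2, h3⟩⟩
      intro b hb
      rcases List.mem_cons.1 hb with rfl | hb
      · exact hj
      · exact (h2 b hb).trans hj

lemma map_cell_mem_cellPaths {s : ℝ} (hs : 0 < s) (m : ℕ) (c : List (Particle d)) {x : Space d}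
    {r : ℝ} {n : ℕ} (hr : r ≤ s / 2) (hR : ∀ p ∈ c, p.radius ≤ s / 2) (ht : Touches x r c)
    (hn : ∀ p ∈ c, slabIndex m p.time < n)
    (hc : c.Pairwise fun p q => slabIndex m q.time < slabIndex m p.time) :
    c.map (fun p => (cubeIndex s p.loc, slabIndex m p.time)) ∈
      cellPaths c.length (cubeIndex s x) n := by
  induction c generalizing x r n with
  | nil => simp [cellPaths]
  | cons p c ih =>
    rw [List.pairwise_cons] at hc
    have hpR := hR p List.mem_cons_self
    rw [List.map_cons, List.length_cons, cons_mem_cellPaths]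
    exact ⟨hn p List.mem_cons_self, cubeIndex_mem_nearby hs (by linarith [ht.1]),
      ih hpR (fun q hq => hR q (List.mem_cons_of_mem _ hq)) ht.2 hc.1 hc.2⟩

lemma eventually_slabIndex_lt {u v : ℝ} (huv : u < v) (hv : 0 ≤ u) :
    ∀ᶠ m in atTop, slabIndex m u < slabIndex m v := by
  have h : Tendsto (fun m : ℕ => (v - u) * 2 ^ m) atTop atTop :=
    (tendsto_pow_atTop_atTop_of_one_lt (by norm_num : (1 : ℝ) < 2)).const_mul_atTop
      (sub_pos.2 huv)
  filter_upwards [h.eventually_ge_atTop 1] with m hm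
  have h1 : u * 2 ^ m + 1 ≤ v * 2 ^ m := by linarith
  have := Nat.floor_le_floor h1
  rw [Nat.floor_add_one (by positivity)] at this
  exact this

/-- Finitely many distinct times are separated by all fine enough slabs. -/
lemma Descending.eventually_slabIndex {c : List (Particle d)} (hc : Descending c)
    (h0 : ∀ p ∈ c, 0 ≤ p.time) :
    ∀ᶠ m in atTop, c.Pairwise fun p q => slabIndex m q.time < slabIndex m p.time := by
  simp only [Descending, List.pairwise_iff_get] at hc ⊢
  refine eventually_all.2 fun i => eventually_all.2 fun j => eventually_all.2 fun hij => ?_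
  exact eventually_slabIndex_lt (hc i j hij) (h0 _ (c.get_mem j))

/-- The stack `c` of particles of `C` is admissible below `x` at time `t`. -/
def IsPath (C : Set (Particle d)) (t Rmax : ℝ) (x : Space d) (c : List (Particle d)) : Prop :=
  Descending c ∧ (∀ p ∈ c, p ∈ C ∧ p.time ∈ Set.Icc 0 t ∧ p.radius ∈ Set.Ioc 0 Rmax) ∧
    Touches x 0 c

lemma IsPath.take {C : Set (Particle d)} {t Rmax : ℝ} {x : Space d} {c : List (Particle d)}
    (h : IsPath C t Rmax x c) (k : ℕ) : IsPath C t Rmax x (c.take k) :=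
  ⟨List.Pairwise.sublist (List.take_sublist k c) h.1, fun p hp => h.2.1 p (List.mem_of_mem_take hp),
    h.2.2.take k⟩

/-! ### Stack-length bound and almost sure regularity -/

section Probability

variable {Ω : Type*} [MeasurableSpace Ω] {Pr : Measure Ω} [IsProbabilityMeasure Pr]
  {F : Measure ℝ} [IsProbabilityMeasure F] {P : Ω → Set (Particle d)}

lemma measure_cellPath_le (hP : IsPoissonProcess P (markedIntensity d F) Pr) {s : ℝ} (hs : 0 < s)
    (m : ℕ) {q : List ((Fin d → ℤ) × ℕ)} (hq : q.Pairwise fun a b => b.2 < a.2) :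
    Pr {ω | ∀ a ∈ q, (P ω ∩ cell s m a).Nonempty} ≤ ENNReal.ofReal (s ^ d / 2 ^ m) ^ q.length := by
  have hne : ∀ a, markedIntensity d F (cell s m a) ≠ ⊤ := fun a =>
    ne_top_of_le_ne_top ENNReal.ofReal_ne_top (markedIntensity_cell_le hs m a)
  have h := hP.measure_forall_nonempty_le (B := fun i : Fin q.length => cell s m (q.get i))
    (fun i => measurableSet_cell hs m _) (fun i => hne _) (by
      intro i j hij
      refine disjoint_cell ?_
      rw [List.pairwise_iff_get] at hq
      rcases lt_or_gt_of_ne hij with h | h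
      · exact (hq i j h).ne'
      · exact (hq j i h).ne)
  refine (measure_mono fun ω hω => ?_).trans (h.trans
    ((Finset.prod_le_prod' fun i _ => markedIntensity_cell_le hs m _).trans ?_))
  · exact fun i => hω _ (q.get_mem i)
  · simp

/-- Union bound with `n.choose k ≤ n ^ k / k!`: the `2 ^ m` slabs per unit time cancel the `2 ^ m`
in the cell intensity, so the bound is uniform in `m`. -/
lemma measure_exists_cellPath_le (hP : IsPoissonProcess P (markedIntensity d F) Pr) {s : ℝ}
    (hs : 0 < s) (m k n : ℕ) (z : Fin d → ℤ) {u : ℝ} (hu : (n : ℝ) ≤ u * 2 ^ m) :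
    Pr {ω | ∃ q ∈ cellPaths k z n, ∀ a ∈ q, (P ω ∩ cell s m a).Nonempty} ≤
      ENNReal.ofReal (((3 * s) ^ d * u) ^ k / k.factorial) := by
  have h1 : {ω | ∃ q ∈ cellPaths k z n, ∀ a ∈ q, (P ω ∩ cell s m a).Nonempty} =
      ⋃ q ∈ cellPaths k z n, {ω | ∀ a ∈ q, (P ω ∩ cell s m a).Nonempty} := by
    ext ω
    simp
  rw [h1]
  refine (measure_biUnion_finset_le _ _).trans ((Finset.sum_le_sum (g := fun _ =>
    ENNReal.ofReal (s ^ d / 2 ^ m) ^ k) fun q hq => ?_).trans ?_)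
  · have := measure_cellPath_le hP hs m (cellPaths_spec hq).2.2
    rwa [(cellPaths_spec hq).1] at this
  · have hc : ((cellPaths k z n).card : ℝ) ≤ (3 ^ d) ^ k * ((u * 2 ^ m) ^ k / k.factorial) := by
      calc ((cellPaths k z n).card : ℝ) ≤ (3 ^ d) ^ k * n.choose k := by
            exact_mod_cast card_cellPaths_le k z n
        _ ≤ (3 ^ d) ^ k * ((n : ℝ) ^ k / k.factorial) := by
            gcongr
            exact Nat.choose_le_pow_div k n
        _ ≤ _ := by gcongr
    rw [Finset.sum_const, nsmul_eq_mul, ← ENNReal.ofReal_natCast,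
      ← ENNReal.ofReal_pow (by positivity), ← ENNReal.ofReal_mul (by positivity)]
    refine ENNReal.ofReal_le_ofReal ((mul_le_mul_of_nonneg_right hc (by positivity)).trans
      (le_of_eq ?_))
    have h2 : (2 : ℝ) ^ m ≠ 0 := by positivity
    rw [mul_pow, mul_pow, mul_pow, div_pow]
    field_simp
    ring

/-- Long stacks are unlikely. -/
theorem measure_exists_isPath_le (hP : IsPoissonProcess P (markedIntensity d F) Pr) {Rmax : ℝ}
    (hR : 0 < Rmax) {t : ℝ} (ht : 0 ≤ t) (x : Space d) (k : ℕ) :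
    Pr {ω | ∃ c, c.length = k ∧ IsPath (P ω) t Rmax x c} ≤
      ENNReal.ofReal (((6 * Rmax) ^ d * (t + 1)) ^ k / k.factorial) := by
  set s := 2 * Rmax with hs
  have hs0 : 0 < s := by positivity
  -- The number of slabs meeting `[0, t]`, including the one that contains `t`.
  let n : ℕ → ℕ := fun m => ⌊t * 2 ^ m⌋₊ + 1
  let E : ℕ → Set Ω := fun m =>
    {ω | ∃ q ∈ cellPaths k (cubeIndex s x) (n m), ∀ a ∈ q, (P ω ∩ cell s m a).Nonempty}
  have hE : ∀ m, Pr (E m) ≤ ENNReal.ofReal (((6 * Rmax) ^ d * (t + 1)) ^ k / k.factorial) := by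
    intro m
    rw [show 6 * Rmax = 3 * s by rw [hs]; ring]
    refine measure_exists_cellPath_le hP hs0 m k (n m) _ ?_
    have h1 : ((n m : ℕ) : ℝ) ≤ t * 2 ^ m + 1 := by
      simp only [n, Nat.cast_add, Nat.cast_one]
      have := Nat.floor_le (show 0 ≤ t * 2 ^ m by positivity)
      linarith
    have h2 : (1 : ℝ) ≤ 2 ^ m := one_le_pow₀ (by norm_num)
    linarith
  -- The scale that separates the times depends on the stack, so only the liminf of the events `E m`
  -- is available; as an increasing union it inherits their uniform bound.
  have hsub : {ω | ∃ c, c.length = k ∧ IsPath (P ω) t Rmax x c} ⊆ ⋃ m₀, ⋂ m ≥ m₀, E m := by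
    rintro ω ⟨c, rfl, hd, hm, htc⟩
    obtain ⟨m₀, hm₀⟩ := eventually_atTop.1 (hd.eventually_slabIndex fun p hp => (hm p hp).2.1.1)
    refine Set.mem_iUnion.2 ⟨m₀, Set.mem_iInter₂.2 fun m hmm => ?_⟩
    refine ⟨_, map_cell_mem_cellPaths hs0 m c (by positivity)
      (fun p hp => by linarith [(hm p hp).2.2.2]) htc (fun p hp => ?_) (hm₀ m hmm), ?_⟩
    · refine Nat.lt_succ_of_le (Nat.floor_le_floor ?_)
      have := (hm p hp).2.1.2
      gcongr
    · intro a ha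
      obtain ⟨p, hp, rfl⟩ := List.mem_map.1 ha
      exact ⟨p, (hm p hp).1, rfl, (hm p hp).2.1.1, rfl⟩
  refine (measure_mono hsub).trans ?_
  have hmono : Monotone fun m₀ => ⋂ m ≥ m₀, E m := fun a b hab =>
    Set.biInter_subset_biInter_left fun m hm => le_trans hab hm
  rw [hmono.measure_iUnion]
  exact iSup_le fun m₀ => (measure_mono (Set.biInter_subset_of_mem (le_refl m₀))).trans (hE m₀)

lemma ae_exists_no_path (hP : IsPoissonProcess P (markedIntensity d F) Pr) {Rmax : ℝ}
    (hR : 0 < Rmax) {t : ℝ} (ht : 0 ≤ t) (x : Space d) :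
    ∀ᵐ ω ∂Pr, ∃ k, ∀ c, IsPath (P ω) t Rmax x c → c.length < k := by
  have h0 : Pr (⋂ k, {ω | ∃ c, c.length = k ∧ IsPath (P ω) t Rmax x c}) = 0 := by
    have hlim : Tendsto (fun k : ℕ =>
        ENNReal.ofReal (((6 * Rmax) ^ d * (t + 1)) ^ k / k.factorial)) atTop (𝓝 0) := by
      rw [← ENNReal.ofReal_zero]
      exact ENNReal.tendsto_ofReal (FloorSemiring.tendsto_pow_div_factorial_atTop _)
    exact nonpos_iff_eq_zero.1 (ge_of_tendsto' hlim fun k =>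
      (measure_mono (Set.iInter_subset _ k)).trans (measure_exists_isPath_le hP hR ht x k))
  filter_upwards [measure_eq_zero_iff_ae_notMem.1 h0] with ω hω
  simp only [Set.mem_iInter, not_forall] at hω
  obtain ⟨k, hk⟩ := hω
  refine ⟨k, fun c hc => ?_⟩
  by_contra! hlen
  exact hk ⟨c.take k, by simp [hlen], hc.take k⟩

lemma ae_finite_window (hP : IsPoissonProcess P (markedIntensity d F) Pr) (t : ℝ) :
    ∀ᵐ ω ∂Pr, ∀ M, (P ω ∩ window d t M).Finite :=
  ae_all_iff.2 fun M => hP.ae_finite (measurableSet_window t M) (markedIntensity_window_ne_top t M)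

/-- `F` gives full mass to `(0, Rmax]`, so in each of countably many windows the other radii have
zero intensity. -/
lemma ae_radius_mem (hP : IsPoissonProcess P (markedIntensity d F) Pr) {Rmax : ℝ}
    (hF0 : cdf F 0 = 0) (hFR : cdf F Rmax = 1) (t : ℝ) :
    ∀ᵐ ω ∂Pr, ∀ p ∈ P ω, p.time ∈ Set.Icc 0 t → p.radius ∈ Set.Ioc 0 Rmax := by
  have hF : F (Set.Ioc 0 Rmax)ᶜ = 0 := by
    rw [prob_compl_eq_zero_iff measurableSet_Ioc, ← measure_cdf F, StieltjesFunction.measure_Ioc,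
      hF0, hFR]
    simp
  let B : ℕ → Set (Particle d) := fun M =>
    {p | p.loc ∈ {x : Space d | ∀ i, x i ∈ Set.Ico (-M : ℝ) M} ∧ p.time ∈ Set.Icc 0 t ∧
      p.radius ∈ (Set.Ioc 0 Rmax)ᶜ}
  have hB : ∀ M, MeasurableSet (B M) := fun M =>
    (measurable_loc (measurableSet_box (fun _ => (-M : ℝ)) fun _ => (M : ℝ))).inter
      ((measurable_time measurableSet_Icc).inter (measurable_radius measurableSet_Ioc.compl))
  have h : ∀ᵐ ω ∂Pr, ∀ M, P ω ∩ B M = ∅ := ae_all_iff.2 fun M => hP.ae_empty (hB M) (by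
    rw [markedIntensity_box _ _ _ measurableSet_Icc, hF, mul_zero, mul_zero])
  filter_upwards [h] with ω hω p hp ht
  by_contra hcon
  obtain ⟨M, hM⟩ := (exists_mem_window ht).exists
  have : p ∈ P ω ∩ B M := ⟨hp, hM.1, ht, hcon⟩
  rw [hω M] at this
  exact this

/-- Simultaneous arrivals share a slab at every scale. About `t * 2 ^ m` slabs each hold two points
with probability `O(4 ^ (-m))`, and the total tends to zero. -/
lemma ae_time_injOn_window (hP : IsPoissonProcess P (markedIntensity d F) Pr) {t : ℝ}
    (ht : 0 ≤ t) (M : ℕ) :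
    ∀ᵐ ω ∂Pr, ∀ p ∈ P ω ∩ window d t M, ∀ q ∈ P ω ∩ window d t M, p.time = q.time → p = q := by
  let A : Set (Space d) := {x | ∀ i, x i ∈ Set.Ico (-M : ℝ) M}
  let I : ℕ → ℕ → Set ℝ := fun m j => Set.Ico ((j : ℝ) / 2 ^ m) ((j + 1) / 2 ^ m)
  let B : ℕ → ℕ → Set (Particle d) := fun m j =>
    {p | p.loc ∈ A ∧ p.time ∈ I m j ∧ p.radius ∈ Set.univ}
  have hA : MeasurableSet A := measurableSet_box (fun _ => (-M : ℝ)) fun _ => (M : ℝ)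
  have hB : ∀ m j, MeasurableSet (B m j) := fun m j =>
    (measurable_loc hA).inter
      ((measurable_time measurableSet_Ico).inter (measurable_radius MeasurableSet.univ))
  obtain ⟨v, hv0, hv⟩ : ∃ v : ℝ, 0 ≤ v ∧ volume A = ENNReal.ofReal v := by
    refine ⟨(volume A).toReal, ENNReal.toReal_nonneg, (ENNReal.ofReal_toReal ?_).symm⟩
    rw [volume_box (fun _ => (-M : ℝ)) fun _ => (M : ℝ)]
    exact ENNReal.prod_ne_top fun _ _ => ENNReal.ofReal_ne_top
  have hμ : ∀ m j, markedIntensity d F (B m j) ≤ ENNReal.ofReal (v / 2 ^ m) := fun m j => by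
    rw [markedIntensity_box _ _ _ measurableSet_Ico, measure_univ, mul_one, hv]
    refine (mul_le_mul_right (measure_mono Set.inter_subset_left) _).trans ?_
    rw [Real.volume_Ico, ← sub_div, add_sub_cancel_left, ← ENNReal.ofReal_mul hv0]
    refine ENNReal.ofReal_le_ofReal (le_of_eq ?_)
    ring
  let bad : Set Ω := {ω | ¬ ∀ p ∈ P ω ∩ window d t M, ∀ q ∈ P ω ∩ window d t M,
    p.time = q.time → p = q}
  have hbad : ∀ m : ℕ, Pr bad ≤ ENNReal.ofReal ((t + 1) * v ^ 2 * (1 / 2) ^ m) := by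
    intro m
    have hsub : bad ⊆ ⋃ j ∈ Finset.range (⌊t * 2 ^ m⌋₊ + 1), {ω | (P ω ∩ B m j).Nontrivial} := by
      intro ω hω
      simp only [bad, Set.mem_ofPred_eq, not_forall] at hω
      obtain ⟨p, hp, q, hq, hpq, hne⟩ := hω
      have h2 : (0 : ℝ) < 2 ^ m := by positivity
      have hmem : p.time ∈ I m ⌊p.time * 2 ^ m⌋₊ := by
        simp only [I, Set.mem_Ico]
        rw [div_le_iff₀ h2, lt_div_iff₀ h2]
        exact ⟨Nat.floor_le (mul_nonneg hp.2.2.1 h2.le), Nat.lt_floor_add_one _⟩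
      refine Set.mem_iUnion₂.2 ⟨⌊p.time * 2 ^ m⌋₊, ?_, p, ⟨hp.1, hp.2.1, hmem, trivial⟩, q,
        ⟨hq.1, hq.2.1, hpq ▸ hmem, trivial⟩, hne⟩
      rw [Finset.mem_range]
      refine Nat.lt_succ_of_le (Nat.floor_le_floor ?_)
      have := hp.2.2.2
      gcongr
    refine (measure_mono hsub).trans ((measure_biUnion_finset_le _ _).trans
      ((Finset.sum_le_sum (g := fun _ => ENNReal.ofReal (v / 2 ^ m) ^ 2) fun j _ => ?_).trans ?_))
    · refine (hP.measure_nontrivial_le (hB m j)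
        (ne_top_of_le_ne_top ENNReal.ofReal_ne_top (hμ m j))).trans ?_
      exact pow_le_pow_left' (hμ m j) 2
    · rw [Finset.sum_const, Finset.card_range, nsmul_eq_mul, ← ENNReal.ofReal_natCast,
        ← ENNReal.ofReal_pow (by positivity), ← ENNReal.ofReal_mul (by positivity)]
      refine ENNReal.ofReal_le_ofReal ?_
      have h1 : ((⌊t * 2 ^ m⌋₊ + 1 : ℕ) : ℝ) ≤ (t + 1) * 2 ^ m := by
        push_cast
        have := Nat.floor_le (show 0 ≤ t * 2 ^ m by positivity)
        have h2 : (1 : ℝ) ≤ 2 ^ m := one_le_pow₀ (by norm_num)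
        linarith
      refine (mul_le_mul_of_nonneg_right h1 (by positivity)).trans (le_of_eq ?_)
      rw [div_pow, div_pow, one_pow]
      field_simp
  have hlim : Tendsto (fun m : ℕ => ENNReal.ofReal ((t + 1) * v ^ 2 * (1 / 2) ^ m)) atTop
      (𝓝 0) := by
    rw [← ENNReal.ofReal_zero]
    refine ENNReal.tendsto_ofReal ?_
    have := (tendsto_pow_atTop_nhds_zero_of_lt_one (by norm_num : (0 : ℝ) ≤ 1 / 2)
      (by norm_num)).const_mul ((t + 1) * v ^ 2)
    rwa [mul_zero] at this
  have h0 : Pr bad = 0 := nonpos_iff_eq_zero.1 (ge_of_tendsto' hlim hbad)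
  exact h0

end Probability

/-! ### Stabilisation as the substrate grows -/

lemma eventually_mem_region {Q : ℕ → Finset (Fin d → ℤ)}
    (hQ : (⋃ n, ⋂ m, ⋂ (_ : n ≤ m), (Q m : Set (Fin d → ℤ))) = Set.univ) (x : Space d) :
    ∀ᶠ n in atTop, x ∈ region (Q n) := by
  have hz : (fun i => ⌊x i⌋ : Fin d → ℤ) ∈ ⋃ n, ⋂ m, ⋂ (_ : n ≤ m), (Q m : Set (Fin d → ℤ)) :=
    hQ ▸ Set.mem_univ _
  obtain ⟨n, hn⟩ := Set.mem_iUnion.1 hz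
  filter_upwards [eventually_ge_atTop n] with m hm
  refine ⟨_, Finset.mem_coe.1 (Set.mem_iInter₂.1 hn m hm), fun i => ⟨?_, ?_⟩⟩
  · linarith [Int.floor_le (x i)]
  · linarith [Int.lt_floor_add_one (x i)]

lemma exists_region_subset (Q : Finset (Fin d → ℤ)) :
    ∃ M : ℕ, ∀ x ∈ region Q, ∀ i, x i ∈ Set.Ico (-M : ℝ) M := by
  have h : ∀ᶠ M : ℕ in atTop, ∀ z ∈ Q, ∀ i, |(z i : ℝ)| + 1 ≤ M :=
    (eventually_all_finset Q).2 fun z _ => eventually_all.2 fun i =>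
      tendsto_natCast_atTop_atTop.eventually_ge_atTop (|(z i : ℝ)| + 1)
  obtain ⟨M, hM⟩ := h.exists
  refine ⟨M, ?_⟩
  rintro x ⟨z, hz, hx⟩ i
  obtain ⟨h1, h2⟩ := abs_le.1 (le_sub_iff_add_le.2 (hM z hz i))
  obtain ⟨h3, h4⟩ := hx i
  exact ⟨by linarith, by linarith⟩

lemma exists_window_of_dist_le (t : ℝ) (x : Space d) (ρ : ℝ) :
    ∃ M : ℕ, ∀ p : Particle d, p.time ∈ Set.Icc 0 t → dist x p.loc ≤ ρ → p ∈ window d t M := by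
  obtain ⟨M, hM⟩ := exists_nat_gt (‖x‖ + ρ)
  refine ⟨M, fun p hp hx => ⟨fun i => ?_, hp⟩⟩
  have h1 : |p.loc i| ≤ ‖p.loc‖ := by simpa using PiLp.norm_apply_le p.loc i
  have h2 : ‖p.loc‖ ≤ ‖x‖ + dist x p.loc := by
    rw [dist_eq_norm, ← norm_sub_rev]
    have := norm_add_le x (p.loc - x)
    rwa [add_sub_cancel] at this
  obtain ⟨h3, h4⟩ := abs_lt.1 (show |p.loc i| < M by linarith)
  exact ⟨h3.le, h4⟩

/-- When stacks below `x` have bounded length, the heights above `x` are eventually equal to the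
largest height of a stack. -/
theorem exists_isGreatest_pathHeights {Q : ℕ → Finset (Fin d → ℤ)}
    (hQ : (⋃ n, ⋂ m, ⋂ (_ : n ≤ m), (Q m : Set (Fin d → ℤ))) = Set.univ)
    {C : Set (Particle d)} {t Rmax : ℝ} {x : Space d} (hRm : 0 < Rmax)
    (hfin : ∀ M, (C ∩ window d t M).Finite)
    (hinj : ∀ M, ∀ p ∈ C ∩ window d t M, ∀ q ∈ C ∩ window d t M, p.time = q.time → p = q)
    (hR : ∀ p ∈ C, p.time ∈ Set.Icc 0 t → p.radius ∈ Set.Ioc 0 Rmax)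
    (hk : ∃ k, ∀ c, IsPath C t Rmax x c → c.length < k) :
    ∃ H, IsGreatest (pathHeights C t x) H ∧ ∀ᶠ n in atTop, height C (region (Q n)) t x = H := by
  obtain ⟨k, hk⟩ := hk
  -- Every particle of a stack below `x` lies in this finite set, since each of fewer than `k` steps
  -- moves by at most `2 * Rmax`.
  let K : Set (Particle d) := {p | p ∈ C ∧ p.time ∈ Set.Icc 0 t ∧ dist x p.loc ≤ 2 * Rmax * k}
  have hK : K.Finite := by
    obtain ⟨M, hM⟩ := exists_window_of_dist_le t x (2 * Rmax * k)
    exact (hfin M).subset fun p hp => ⟨hp.1, hM p hp.2.1 hp.2.2⟩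
  have hev : ∀ᶠ n in atTop, x ∈ region (Q n) ∧ ∀ p ∈ K, p.loc ∈ region (Q n) :=
    (eventually_mem_region hQ x).and
      ((eventually_all_finite hK).2 fun p _ => eventually_mem_region hQ p.loc)
  have key : ∀ᶠ n in atTop, IsGreatest (pathHeights C t x) (height C (region (Q n)) t x) := by
    filter_upwards [hev] with n hn
    obtain ⟨M, hM⟩ := exists_region_subset (Q n)
    have hsub : restrictTo C (region (Q n)) t ⊆ C ∩ window d t M := fun p hp =>
      ⟨hp.1, hM _ hp.2.1, hp.2.2⟩
    have h := isGreatest_height hn.1 ((hfin M).subset hsub)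
      (fun p hp q hq => hinj M p (hsub hp) q (hsub hq)) fun p hp => (hR p hp.1 hp.2.2).1.le
    convert h using 1
    ext v
    constructor
    · rintro ⟨c, hd, hm, ht, rfl⟩
      have hpath : IsPath C t Rmax x c :=
        ⟨hd, fun p hp => ⟨(hm p hp).1, (hm p hp).2, hR p (hm p hp).1 (hm p hp).2⟩, ht⟩
      have hlen : (c.length : ℝ) ≤ k := by exact_mod_cast (hk c hpath).le
      refine ⟨c, hd, fun p hp => ⟨⟨(hm p hp).1, hn.2 p ⟨(hm p hp).1, (hm p hp).2, ?_⟩⟩,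
        (hm p hp).2⟩, ht, rfl⟩
      refine (ht.dist_le hRm.le (fun p hp => (hpath.2.1 p hp).2.2.2) p hp).trans ?_
      gcongr
    · rintro ⟨c, hd, hm, ht, rfl⟩
      exact ⟨c, hd, fun p hp => ⟨(hm p hp).1.1, (hm p hp).2⟩, ht, rfl⟩
  obtain ⟨n₀, hn₀⟩ := key.exists
  exact ⟨_, hn₀, key.mono fun n hn => hn.unique hn₀⟩

lemma measurePreserving_shift {F : Measure ℝ} [IsProbabilityMeasure F] (v : Space d) :
    MeasurePreserving (shift v) (markedIntensity d F) (markedIntensity d F) :=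
  (measurePreserving_sub_right volume v).prod (MeasurePreserving.id _)

lemma shift_injective (v : Space d) : Function.Injective (shift v) := by
  rintro ⟨x, u, r⟩ ⟨y, u', r'⟩ h
  simpa [shift, Particle.loc, Particle.time, Particle.radius] using h

/-- Since `j ^ j / j! ≤ e ^ j`, the quotient is at most `(e * a / j) ^ j` for `j > 0`. -/
lemma pow_div_factorial_le_half_pow {a : ℝ} (ha : 0 ≤ a) {j : ℕ}
    (hj : 2 * Real.exp 1 * a ≤ j) : a ^ j / j.factorial ≤ (1 / 2) ^ j := by
  have h1 : (j : ℝ) ^ j / j.factorial ≤ Real.exp j :=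
    Real.pow_div_factorial_le_exp _ (Nat.cast_nonneg j) j
  have hf : (0 : ℝ) < j.factorial := by positivity
  have h2 : (2 * Real.exp 1 * a) ^ j ≤ (j : ℝ) ^ j := pow_le_pow_left₀ (by positivity) hj j
  rw [div_le_iff₀ hf] at h1 ⊢
  have h3 : Real.exp j = Real.exp 1 ^ j := by rw [← Real.exp_nat_mul, mul_one]
  rw [h3] at h1
  rw [mul_pow, mul_pow] at h2
  have h4 : Real.exp 1 ^ j * (2 ^ j * a ^ j) ≤ Real.exp 1 ^ j * j.factorial := by linarith
  have h5 := le_of_mul_le_mul_left h4 (by positivity)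
  rw [one_div, inv_pow, ← div_eq_inv_mul, le_div_iff₀ (by positivity)]
  linarith

/-! ### Limit height: existence, stationarity and moments -/

section Probability

variable {Ω : Type*} [MeasurableSpace Ω] {Pr : Measure Ω} [IsProbabilityMeasure Pr]
  {F : Measure ℝ} [IsProbabilityMeasure F] {P : Ω → Set (Particle d)}

omit [IsProbabilityMeasure F] in
lemma pos_of_cdf {Rmax : ℝ} (hF0 : cdf F 0 = 0) (hFR : cdf F Rmax = 1) : 0 < Rmax := by
  by_contra! h
  have := (cdf F).mono h
  rw [hF0, hFR] at this
  linarith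

lemma ae_isGreatest (hP : IsPoissonProcess P (markedIntensity d F) Pr) {Rmax : ℝ}
    (hF0 : cdf F 0 = 0) (hFR : cdf F Rmax = 1) {Q : ℕ → Finset (Fin d → ℤ)}
    (hQ : (⋃ n, ⋂ m, ⋂ (_ : n ≤ m), (Q m : Set (Fin d → ℤ))) = Set.univ) {t : ℝ} (ht : 0 ≤ t)
    (x : Space d) :
    ∀ᵐ ω ∂Pr, IsGreatest (pathHeights (P ω) t x) (limitHeight (P ω) Q t x) ∧
      Tendsto (fun n => height (P ω) (region (Q n)) t x) atTop (𝓝 (limitHeight (P ω) Q t x)) := by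
  have hRm := pos_of_cdf hF0 hFR
  filter_upwards [ae_finite_window hP t, ae_all_iff.2 fun M => ae_time_injOn_window hP ht M,
    ae_radius_mem hP hF0 hFR t, ae_exists_no_path hP hRm ht x] with ω h1 h2 h3 h4
  obtain ⟨H, hH, hev⟩ := exists_isGreatest_pathHeights hQ hRm h1 h2 h3 h4
  have hlim : Tendsto (fun n => height (P ω) (region (Q n)) t x) atTop (𝓝 H) :=
    tendsto_const_nhds.congr' (hev.mono fun n hn => hn.symm)
  have : limitHeight (P ω) Q t x = H := hlim.limUnder_eq
  rw [this]
  exact ⟨hH, hlim⟩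

lemma IsGreatest.nonneg_of_pathHeights {C : Set (Particle d)} {t : ℝ} {x : Space d} {H : ℝ}
    (h : IsGreatest (pathHeights C t x) H) : 0 ≤ H :=
  h.2 ⟨[], List.Pairwise.nil, by simp, trivial, rfl⟩

/-- Moving `x` to the origin makes the functional the same for all `x`, and supplies the almost
everywhere measurability of `limitHeight`. -/
lemma limitHeight_ae_eq (hP : IsPoissonProcess P (markedIntensity d F) Pr) {Rmax : ℝ}
    (hF0 : cdf F 0 = 0) (hFR : cdf F Rmax = 1) {Q : ℕ → Finset (Fin d → ℤ)}
    (hQ : (⋃ n, ⋂ m, ⋂ (_ : n ≤ m), (Q m : Set (Fin d → ℤ))) = Set.univ) {t : ℝ} (ht : 0 ≤ t)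
    (x : Space d) :
    (fun ω => (supHeight F t 0 (shift x '' P ω)).toReal) =ᵐ[Pr]
      fun ω => limitHeight (P ω) Q t x := by
  have hP' := hP.image (measurePreserving_shift x) (shift_injective x)
  filter_upwards [ae_isGreatest hP hF0 hFR hQ ht x, ae_finite_window hP' t] with ω h1 h2
  have h3 : IsGreatest (pathHeights (shift x '' P ω) t 0) (limitHeight (P ω) Q t x) := by
    have := pathHeights_image_shift (P ω) t x x
    rw [sub_self] at this
    rw [this]
    exact h1.1
  rw [supHeight_eq h2 h3, ENNReal.toReal_ofReal (IsGreatest.nonneg_of_pathHeights h3)]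

theorem identDistrib_limitHeight (hP : IsPoissonProcess P (markedIntensity d F) Pr) {Rmax : ℝ}
    (hF0 : cdf F 0 = 0) (hFR : cdf F Rmax = 1) {Q : ℕ → Finset (Fin d → ℤ)}
    (hQ : (⋃ n, ⋂ m, ⋂ (_ : n ≤ m), (Q m : Set (Fin d → ℤ))) = Set.univ) {t : ℝ} (ht : 0 ≤ t)
    (x y : Space d) :
    IdentDistrib (fun ω => limitHeight (P ω) Q t x) (fun ω => limitHeight (P ω) Q t y) Pr Pr := by
  have hx := hP.image (measurePreserving_shift x) (shift_injective x)
  have hy := hP.image (measurePreserving_shift y) (shift_injective y)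
  have h := (hx.identDistrib hy).comp (measurable_supHeight F t 0).ennreal_toReal
  exact (((IdentDistrib.of_ae_eq h.aemeasurable_fst (limitHeight_ae_eq hP hF0 hFR hQ ht x)).symm).trans
    h).trans (IdentDistrib.of_ae_eq h.aemeasurable_snd (limitHeight_ae_eq hP hF0 hFR hQ ht y))

lemma lintegral_limitHeight_pow_le (hP : IsPoissonProcess P (markedIntensity d F) Pr) {Rmax : ℝ}
    (hF0 : cdf F 0 = 0) (hFR : cdf F Rmax = 1) {Q : ℕ → Finset (Fin d → ℤ)}
    (hQ : (⋃ n, ⋂ m, ⋂ (_ : n ≤ m), (Q m : Set (Fin d → ℤ))) = Set.univ) {t : ℝ} (ht : 0 ≤ t)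
    (x : Space d) (k : ℕ) :
    ∫⁻ ω, ENNReal.ofReal (limitHeight (P ω) Q t x ^ k) ∂Pr ≤
      ENNReal.ofReal ((2 * Rmax) ^ k * (((2 * Real.exp 1 * (6 * Rmax) ^ d + 1) * (t + 1)) ^ k +
        ∑' j : ℕ, (j : ℝ) ^ k * (1 / 2) ^ j)) := by
  have hRm := pos_of_cdf hF0 hFR
  set a : ℝ := (6 * Rmax) ^ d * (t + 1) with ha
  have ha0 : 0 ≤ a := by positivity
  -- From this length on, `a ^ j / j!` is at most `2 ^ (-j)`; shorter stacks are bounded by `M`, of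
  -- order `t`.
  set M : ℕ := ⌈2 * Real.exp 1 * a⌉₊ with hM
  have hMle : (M : ℝ) ≤ (2 * Real.exp 1 * (6 * Rmax) ^ d + 1) * (t + 1) := by
    have := (Nat.ceil_lt_add_one (show 0 ≤ 2 * Real.exp 1 * a by positivity)).le
    rw [← hM] at this
    rw [ha] at this
    nlinarith
  -- Measurable hulls have the same measure and allow integration without measurability of the stack
  -- events.
  let A : ℕ → Set Ω := fun j =>
    toMeasurable Pr {ω | ∃ c, c.length = j ∧ IsPath (P ω) t Rmax x c}
  have hA : ∀ j, M ≤ j → Pr (A j) ≤ ENNReal.ofReal ((1 / 2) ^ j) := fun j hj => by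
    rw [measure_toMeasurable]
    refine (measure_exists_isPath_le hP hRm ht x j).trans (ENNReal.ofReal_le_ofReal ?_)
    exact pow_div_factorial_le_half_pow ha0 ((Nat.le_ceil _).trans (by exact_mod_cast hj))
  let f : ℕ → Ω → ENNReal := fun j =>
    if M ≤ j then (A j).indicator fun _ => ENNReal.ofReal ((j : ℝ) ^ k) else 0
  have hf : ∀ j, Measurable (f j) := fun j => by
    dsimp only [f]
    split_ifs
    · exact measurable_const.indicator (measurableSet_toMeasurable _ _)
    · exact measurable_const
  have hpt : ∀ᵐ ω ∂Pr, ENNReal.ofReal (limitHeight (P ω) Q t x ^ k) ≤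
      ENNReal.ofReal ((2 * Rmax) ^ k) * (ENNReal.ofReal ((M : ℝ) ^ k) + ∑' j, f j ω) := by
    filter_upwards [ae_isGreatest hP hF0 hFR hQ ht x, ae_radius_mem hP hF0 hFR t] with ω h1 h2
    -- A stack attaining the maximum: its length controls the height and selects the term of the
    -- sum.
    obtain ⟨c, hd, hm, htc, hc⟩ := h1.1.1
    have h0 := IsGreatest.nonneg_of_pathHeights h1.1
    have hpath : IsPath (P ω) t Rmax x c :=
      ⟨hd, fun p hp => ⟨(hm p hp).1, (hm p hp).2, h2 p (hm p hp).1 (hm p hp).2⟩, htc⟩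
    have hle : limitHeight (P ω) Q t x ≤ 2 * Rmax * c.length := by
      have := stackHeight_le c x 0 le_rfl fun p hp =>
        ⟨(hpath.2.1 p hp).2.2.1.le, (hpath.2.1 p hp).2.2.2⟩
      rw [hc] at this
      linarith
    have hle' : limitHeight (P ω) Q t x ^ k ≤ (2 * Rmax) ^ k * (c.length : ℝ) ^ k := by
      rw [← mul_pow]
      exact pow_le_pow_left₀ h0 hle k
    refine (ENNReal.ofReal_le_ofReal hle').trans ?_
    rw [ENNReal.ofReal_mul (by positivity)]
    refine mul_le_mul_right ?_ _
    by_cases hlen : M ≤ c.length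
    · refine le_trans ?_ (le_add_left (ENNReal.le_tsum c.length))
      have hmem : ω ∈ A c.length := subset_toMeasurable _ _ ⟨c, rfl, hpath⟩
      simp only [f, if_pos hlen, Set.indicator_of_mem hmem]
      exact le_rfl
    · refine le_trans (ENNReal.ofReal_le_ofReal ?_) (le_add_right le_rfl)
      have : (c.length : ℝ) ≤ M := by exact_mod_cast (not_le.1 hlen).le
      gcongr
  have hint : ∀ j, ∫⁻ ω, f j ω ∂Pr ≤ ENNReal.ofReal ((j : ℝ) ^ k * (1 / 2) ^ j) := fun j => by
    dsimp only [f]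
    split_ifs with hj
    · refine (lintegral_indicator_const_le _ _).trans ?_
      rw [ENNReal.ofReal_mul (by positivity)]
      exact mul_le_mul_right (hA j hj) _
    · simp
  have hsum : Summable fun j : ℕ => (j : ℝ) ^ k * (1 / 2) ^ j :=
    summable_pow_mul_geometric_of_norm_lt_one k (by norm_num)
  have hnn : ∀ j : ℕ, 0 ≤ (j : ℝ) ^ k * (1 / 2) ^ j := fun j => by positivity
  calc _ ≤ ∫⁻ ω, ENNReal.ofReal ((2 * Rmax) ^ k) *
        (ENNReal.ofReal ((M : ℝ) ^ k) + ∑' j, f j ω) ∂Pr := lintegral_mono_ae hpt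
    _ = ENNReal.ofReal ((2 * Rmax) ^ k) *
        (ENNReal.ofReal ((M : ℝ) ^ k) + ∑' j, ∫⁻ ω, f j ω ∂Pr) := by
      rw [lintegral_const_mul' _ _ ENNReal.ofReal_ne_top, lintegral_add_left measurable_const,
        lintegral_const, measure_univ, mul_one, lintegral_tsum fun j => (hf j).aemeasurable]
    _ ≤ ENNReal.ofReal ((2 * Rmax) ^ k) * (ENNReal.ofReal ((M : ℝ) ^ k) +
        ∑' j : ℕ, ENNReal.ofReal ((j : ℝ) ^ k * (1 / 2) ^ j)) := by
      gcongr with j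
      exact hint j
    _ = ENNReal.ofReal ((2 * Rmax) ^ k *
        ((M : ℝ) ^ k + ∑' j : ℕ, (j : ℝ) ^ k * (1 / 2) ^ j)) := by
      rw [← ENNReal.ofReal_tsum_of_nonneg hnn hsum,
        ← ENNReal.ofReal_add (by positivity) (tsum_nonneg hnn),
        ← ENNReal.ofReal_mul (by positivity)]
    _ ≤ _ := by
      refine ENNReal.ofReal_le_ofReal ?_
      gcongr

theorem integrable_limitHeight_pow (hP : IsPoissonProcess P (markedIntensity d F) Pr) {Rmax : ℝ}
    (hF0 : cdf F 0 = 0) (hFR : cdf F Rmax = 1) {Q : ℕ → Finset (Fin d → ℤ)}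
    (hQ : (⋃ n, ⋂ m, ⋂ (_ : n ≤ m), (Q m : Set (Fin d → ℤ))) = Set.univ) {t : ℝ} (ht : 0 ≤ t)
    (x : Space d) (k : ℕ) : Integrable (fun ω => limitHeight (P ω) Q t x ^ k) Pr := by
  -- Identity in law of the height with itself contains its measurability.
  have hm : AEMeasurable (fun ω => limitHeight (P ω) Q t x) Pr :=
    (identDistrib_limitHeight hP hF0 hFR hQ ht x x).aemeasurable_fst
  refine ⟨(hm.pow_const k).aestronglyMeasurable, ?_⟩
  have h0 : ∀ᵐ ω ∂Pr, 0 ≤ limitHeight (P ω) Q t x ^ k := by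
    filter_upwards [ae_isGreatest hP hF0 hFR hQ ht x] with ω h
    exact pow_nonneg (IsGreatest.nonneg_of_pathHeights h.1) k
  rw [hasFiniteIntegral_iff_ofReal h0]
  exact (lintegral_limitHeight_pow_le hP hF0 hFR hQ ht x k).trans_lt ENNReal.ofReal_lt_top

theorem isBigO_integral_limitHeight_pow (hP : IsPoissonProcess P (markedIntensity d F) Pr)
    {Rmax : ℝ} (hF0 : cdf F 0 = 0) (hFR : cdf F Rmax = 1) {Q : ℕ → Finset (Fin d → ℤ)}
    (hQ : (⋃ n, ⋂ m, ⋂ (_ : n ≤ m), (Q m : Set (Fin d → ℤ))) = Set.univ) (x : Space d) (k : ℕ) :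
    (fun t : ℝ => ∫ ω, limitHeight (P ω) Q t x ^ k ∂Pr) =O[atTop] fun t : ℝ => t ^ k := by
  have hRm := pos_of_cdf hF0 hFR
  set K : ℝ := 2 * Real.exp 1 * (6 * Rmax) ^ d + 1 with hK
  have hK0 : 0 ≤ K := by positivity
  set z : ℝ := ∑' j : ℕ, (j : ℝ) ^ k * (1 / 2) ^ j with hz
  have hz0 : 0 ≤ z := tsum_nonneg fun j => by positivity
  refine Asymptotics.IsBigO.of_bound ((2 * Rmax) ^ k * ((K * 2) ^ k + z)) ?_
  -- For `t ≥ 1` both `t + 1 ≤ 2 * t` and `z ≤ z * t ^ k` hold, whence the constant.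
  filter_upwards [eventually_ge_atTop 1] with t ht1
  have ht : 0 ≤ t := by linarith
  have h0 : 0 ≤ᵐ[Pr] fun ω => limitHeight (P ω) Q t x ^ k := by
    filter_upwards [ae_isGreatest hP hF0 hFR hQ ht x] with ω h
    exact pow_nonneg (IsGreatest.nonneg_of_pathHeights h.1) k
  have hint : ∫ ω, limitHeight (P ω) Q t x ^ k ∂Pr ≤
      (2 * Rmax) ^ k * ((K * (t + 1)) ^ k + z) := by
    rw [integral_eq_lintegral_of_nonneg_ae h0
      (integrable_limitHeight_pow hP hF0 hFR hQ ht x k).aestronglyMeasurable]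
    exact ENNReal.toReal_le_of_le_ofReal (by positivity)
      (lintegral_limitHeight_pow_le hP hF0 hFR hQ ht x k)
  rw [Real.norm_of_nonneg (integral_nonneg_of_ae h0), Real.norm_of_nonneg (by positivity)]
  have h1 : (K * (t + 1)) ^ k ≤ (K * 2) ^ k * t ^ k := by
    rw [← mul_pow]
    refine pow_le_pow_left₀ (by positivity) ?_ k
    nlinarith
  have h2 : z ≤ z * t ^ k := le_mul_of_one_le_right hz0 (one_le_pow₀ ht1)
  refine hint.trans ?_
  rw [mul_assoc]
  refine mul_le_mul_of_nonneg_left ?_ (by positivity)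
  linarith

end Probability

end BallisticDeposition

open BallisticDeposition in
theorem proposition3p1 (d : ℕ) (hd : 1 ≤ d)
    -- the common law of the radii, bounded by `Rmax`
    (F : Measure ℝ) [IsProbabilityMeasure F] (Rmax : ℝ)
    (hF0 : cdf F 0 = 0) (hFR : cdf F Rmax = 1)
    -- the finite substrates, with `liminf Q n = ℤ^d`
    (Q : ℕ → Finset (Fin d → ℤ))
    (hQ : (⋃ n, ⋂ m, ⋂ (_ : n ≤ m), (Q m : Set (Fin d → ℤ))) = Set.univ)
    -- the marked Poisson process
    {Ω : Type*} [MeasurableSpace Ω] (Pr : Measure Ω) [IsProbabilityMeasure Pr]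
    (P : Ω → Set (Particle d)) (hP : IsPoissonProcess P (markedIntensity d F) Pr) :
    -- the limit exists and is finite, almost surely
    (∀ t : ℝ, 0 ≤ t → ∀ x : Space d, ∀ᵐ ω ∂Pr,
      Tendsto (fun n => height (P ω) (region (Q n)) t x) atTop (𝓝 (limitHeight (P ω) Q t x))) ∧
    -- its distribution does not depend on the location
    (∀ t : ℝ, 0 ≤ t → ∀ x y : Space d,
      IdentDistrib (fun ω => limitHeight (P ω) Q t x) (fun ω => limitHeight (P ω) Q t y) Pr Pr) ∧
    -- moments: they are finite, and of order `t ^ k`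
    (∀ k : ℕ,
      (∀ t : ℝ, 0 ≤ t → Integrable (fun ω => limitHeight (P ω) Q t 0 ^ k) Pr) ∧
      (fun t : ℝ => ∫ ω, limitHeight (P ω) Q t 0 ^ k ∂Pr) =O[atTop] fun t : ℝ => t ^ k) := by
  exact ⟨fun t ht x => (ae_isGreatest hP hF0 hFR hQ ht x).mono fun _ h => h.2,
    fun t ht x y => identDistrib_limitHeight hP hF0 hFR hQ ht x y,
    fun k => ⟨fun t ht => integrable_limitHeight_pow hP hF0 hFR hQ ht 0 k,
      isBigO_integral_limitHeight_pow hP hF0 hFR hQ 0 k⟩⟩
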